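/- **Network Pollaczek–Khintchine formula for component sums.** Let $q,d\in\mathbb N$. For $j=1,\dots,d$ let $V_j(t)=\sum_{k=1}^{N_j(t)}X_j(k)-c_jt$, $t\ge 0$, be independent compound Poisson processes, where $c_j>0$, $N_j$ is a Poisson process with intensity $\lambda_j>0$, and the jumps $X_j(k)$, $k\ge1$, are i.i.d., independent of $N_j$, with finite mean $\mu_j$ and distribution function $F_j$ such that $F_j(0)=0$; write $\overline F_j=1-F_j$. Consider a random bipartite network of $q$ agents and $d$ objects, with $i\sim j$ if there is an edge between agent $i$ and object $j$, with random weights $W^i_j\in[0,1]$ (which may depend on the network) and with weighted adjacency matrix $A^i_j=\mathbf 1\{i\sim j\}W^i_j$, such that $\sum_{i=1}^qA^i_j\le1$ for all $j$ and $A=(A^i_j)$ is independent of $V=(V_1,\dots,V_d)$. Let $R^i(t)=\sum_{j=1}^dA^i_jV_j(t)$. For $Q\subseteq\{1,\dots,q\}$ let $S_j=\sum_{i\in Q}A^i_j$, let $\deg(Q)$ be the number of edges $i\sim j$ with $i\in Q$, write $Q\sim j$ if $i\sim j$ for some $i\in Q$, and set $$P^Q=\frac{\sum_{j=1}^dS_j\lambda_j\mu_j}{\sum_{j=1}^dS_jc_j}\,\mathbf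 1\{\deg(Q)>0\}\quad\Big(\tfrac00:=0\Big),$$ $$F^Q_I(x)=\Big(\sum_{j=1}^dS_j\lambda_j\mu_j\Big)^{-1}\sum_{j=1}^d\lambda_j\mathbf 1\{Q\sim j\}\int_0^x\overline F_j\Big(\frac y{S_j}\Big)\,dy,\quad x\ge0,$$ where $\overline F_j(y/0):=0$, and $F^Q_I:=0$ if all $S_j$ vanish (its value is then irrelevant, as $P^Q=0$). For a distribution function $G$ on $[0,\infty)$ let $G^{0*}(t)=\mathbf 1\{t\ge0\}$, $G^{(n+1)*}(t)=\int_{[0,t]}G^{n*}(t-y)\,dG(y)$ and $\overline{G^{n*}}=1-G^{n*}$. Then for every $Q\subseteq\{1,\dots,q\}$ and every $u\in[0,\infty)^q$ with $\sum_{i\in Q}u^i>0$ the hitting probability $$\Psi^Q(u)=\mathbb P\Big(\sum_{i\in Q}(R^i(t)-u^i)\ge0\text{ for some }t\ge0\Big)$$ satisfies $$\Psi^Q(u)=\mathbb P(P^Q<1)\;\mathbb E\Big[(1-P^Q)\sum_{n=1}^\infty(P^Q)^n\,\overline{(F^Q_I)^{n*}}\Big(\sum_{i\in Q}u^i\Big)\,\Big|\,P^Q<1\Big]+\mathbb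 P(P^Q\ge1),$$ where the first summand is $0$ if $\mathbb P(P^Q<1)=0$. Here the hitting event is measurable with respect to the completion of $\mathbb P$, the series converges whenever $P^Q<1$, and the random variable in the conditional expectation is integrable with respect to $\mathbb P(\,\cdot\mid P^Q<1)$. -/

import Mathlib

open MeasureTheory ProbabilityTheory Set
open scoped NNReal

/-- `N` is a Poisson process with intensity `lam`: it starts in `0`, has independent increments,
`N t - N s` is Poisson distributed with parameter `lam * (t - s)`, and almost all of its paths are
nondecreasing and right-continuous. As almost all paths are nondecreasing, the truncated
subtraction of `ℕ` is almost surely the true one. -/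
structure IsPoissonProcess {Ω : Type*} [MeasurableSpace Ω] (N : ℝ≥0 → Ω → ℕ) (lam : ℝ≥0)
    (P : Measure Ω) : Prop where
  measurable : ∀ t, Measurable (N t)
  zero : ∀ᵐ ω ∂P, N 0 ω = 0
  monotone : ∀ᵐ ω ∂P, Monotone fun t => N t ω
  rightContinuous : ∀ᵐ ω ∂P, ∀ t, ContinuousWithinAt (fun s => N s ω) (Ici t) t
  indepIncrements : HasIndepIncrements N P
  law : ∀ s t, s ≤ t → HasLaw (fun ω => N t ω - N s ω) (poissonMeasure (lam * (t - s))) P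

/-- The process `∑_{k ≤ N(t)} X(k) - c t` (the jumps are numbered from `0`). -/
noncomputable def compoundProcess {Ω : Type*} (N : ℝ≥0 → Ω → ℕ) (X : ℕ → Ω → ℝ) (c : ℝ)
    (t : ℝ≥0) (ω : Ω) : ℝ :=
  ∑ k ∈ Finset.range (N t ω), X k ω - c * t

/-- `n`-fold convolution `G^{n*}` of a distribution function `G` on `[0, ∞)`:
`G^{0*}(t) = 1{t ≥ 0}` and `G^{(n+1)*}(t) = ∫_{[0,t]} G^{n*}(t - y) dG(y)`, with the
Lebesgue-Stieltjes measure `dG` of `G`. -/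
noncomputable def convPow (G : StieltjesFunction ℝ) : ℕ → ℝ → ℝ
  | 0 => (Ici (0 : ℝ)).indicator 1
  | n + 1 => fun t => ∫ y in Icc 0 t, convPow G n (t - y) ∂G.measure

/-- `1 - F(y / s)` for the distribution function `F` of `ν`, with `y / 0 = ∞` and `F(∞) = 1`. -/
noncomputable def scaledTail (ν : Measure ℝ) (s y : ℝ) : ℝ :=
  if s = 0 then 0 else 1 - cdf ν (y / s)

/-- The random bipartite network with `q` agents and `d` objects, whose `d` objects carry
independent spectrally positive compound Poisson processes. -/
structure NetworkModel {Ω : Type*} [MeasurableSpace Ω] (P : Measure Ω) (q d : ℕ) where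
  /-- intensities `λ_j` -/
  lam : Fin d → ℝ≥0
  /-- drifts `c_j` -/
  c : Fin d → ℝ
  /-- jump distributions, with distribution functions `F_j` -/
  ν : Fin d → Measure ℝ
  /-- Poisson processes `N_j` -/
  N : Fin d → ℝ≥0 → Ω → ℕ
  /-- jump sizes `X_j(k)` -/
  X : Fin d → ℕ → Ω → ℝ
  /-- the event `i ∼ j` that there is an edge between agent `i` and object `j` -/
  edge : Fin q → Fin d → Set Ω
  /-- the weights `W^i_j` -/
  W : Fin q → Fin d → Ω → ℝ
  lam_pos : ∀ j, 0 < lam j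
  c_pos : ∀ j, 0 < c j
  poisson : ∀ j, IsPoissonProcess (N j) (lam j) P
  measurable_X : ∀ j k, Measurable (X j k)
  law_X : ∀ j k, HasLaw (X j k) (ν j) P
  indep_X : ∀ j, iIndepFun (X j) P
  cdf_zero : ∀ j, cdf (ν j) 0 = 0
  integrable_jump : ∀ j, Integrable (fun x : ℝ => x) (ν j)
  indep_N_X : ∀ j, IndepFun (fun ω t => N j t ω) (fun ω k => X j k ω) P
  /-- the components `V_j` are independent processes -/
  indep_V : iIndepFun (fun j ω t => compoundProcess (N j) (X j) (c j) t ω) P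
  measurableSet_edge : ∀ i j, MeasurableSet (edge i j)
  measurable_W : ∀ i j, Measurable (W i j)
  W_mem : ∀ i j ω, W i j ω ∈ Icc (0 : ℝ) 1
  sum_le_one : ∀ j ω, ∑ i, (edge i j).indicator (W i j) ω ≤ 1
  /-- the weighted adjacency matrix is independent of the process `V` -/
  indep_A_V : IndepFun (fun ω i j => (edge i j).indicator (W i j) ω)
    (fun ω j t => compoundProcess (N j) (X j) (c j) t ω) P

namespace NetworkModel

variable {Ω : Type*} [MeasurableSpace Ω] {P : Measure Ω} {q d : ℕ} (M : NetworkModel P q d)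

/-- `V_j(t)` -/
noncomputable def V (j : Fin d) (t : ℝ≥0) (ω : Ω) : ℝ :=
  compoundProcess (M.N j) (M.X j) (M.c j) t ω

/-- mean jump sizes `μ_j` -/
noncomputable def mean (j : Fin d) : ℝ := ∫ x, x ∂(M.ν j)

/-- the weighted adjacency matrix `A^i_j = 1{i ∼ j} W^i_j` -/
noncomputable def A (i : Fin q) (j : Fin d) (ω : Ω) : ℝ := (M.edge i j).indicator (M.W i j) ω

/-- `R(t) = A V(t)` -/
noncomputable def R (i : Fin q) (t : ℝ≥0) (ω : Ω) : ℝ := ∑ j, M.A i j ω * M.V j t ω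

/-- `deg(Q) = ∑_{i ∈ Q} deg(i)` -/
noncomputable def deg (Q : Finset (Fin q)) (ω : Ω) : ℕ :=
  ∑ i ∈ Q, ∑ j, (M.edge i j).indicator 1 ω

/-- the event `Q ∼ j` that some agent of `Q` is connected to object `j` -/
def edgeTo (Q : Finset (Fin q)) (j : Fin d) : Set Ω := ⋃ i ∈ Q, M.edge i j

/-- `∑_{i ∈ Q} A^i_j` -/
noncomputable def share (Q : Finset (Fin q)) (j : Fin d) (ω : Ω) : ℝ := ∑ i ∈ Q, M.A i j ω

/-- The network Pollaczek-Khintchine parameter `P^Q` (with `0 / 0 = 0`). -/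
noncomputable def pkParam (Q : Finset (Fin q)) (ω : Ω) : ℝ :=
  (∑ j, M.share Q j ω * M.lam j * M.mean j) / (∑ j, M.share Q j ω * M.c j) *
    {ω | 0 < M.deg Q ω}.indicator 1 ω

/-- The values `F_I^Q(x)`; for `x < 0` the value is `0`. -/
noncomputable def mixedTailFun (Q : Finset (Fin q)) (ω : Ω) (x : ℝ) : ℝ :=
  (∑ j, M.share Q j ω * M.lam j * M.mean j)⁻¹ *
    ∑ j, M.lam j * (M.edgeTo Q j).indicator 1 ω *
      ∫ y in Ioc 0 x, scaledTail (M.ν j) (M.share Q j ω) y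

theorem A_nonneg (i : Fin q) (j : Fin d) (ω : Ω) : 0 ≤ M.A i j ω :=
  indicator_nonneg (fun ω _ => (M.W_mem i j ω).1) ω

theorem share_nonneg (Q : Finset (Fin q)) (j : Fin d) (ω : Ω) : 0 ≤ M.share Q j ω :=
  Finset.sum_nonneg fun i _ => M.A_nonneg i j ω

theorem mean_nonneg (j : Fin d) [IsProbabilityMeasure P] : 0 ≤ M.mean j := by
  have : IsProbabilityMeasure (M.ν j) := (M.law_X j 0).map_eq ▸
    Measure.isProbabilityMeasure_map (M.measurable_X j 0).aemeasurable
  refine integral_nonneg_of_ae ?_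
  have h := M.cdf_zero j
  rw [cdf_eq_real, measureReal_eq_zero_iff] at h
  filter_upwards [measure_eq_zero_iff_ae_notMem.1 h] with x hx
  exact (not_le.1 hx).le

end NetworkModel

theorem scaledTail_nonneg (ν : Measure ℝ) (s y : ℝ) : 0 ≤ scaledTail ν s y := by
  unfold scaledTail
  split_ifs
  · exact le_rfl
  · linarith [cdf_le_one ν (y / s)]

theorem scaledTail_antitone (ν : Measure ℝ) {s : ℝ} (hs : 0 ≤ s) : Antitone (scaledTail ν s) := by
  intro x y hxy
  unfold scaledTail
  split_ifs
  · exact le_rfl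
  · have := monotone_cdf ν (div_le_div_of_nonneg_right hxy hs)
    linarith

namespace NetworkModel

variable {Ω : Type*} [MeasurableSpace Ω] {P : Measure Ω} {q d : ℕ} (M : NetworkModel P q d)

theorem integrableOn_scaledTail (Q : Finset (Fin q)) (j : Fin d) (ω : Ω) (a b : ℝ) :
    IntegrableOn (scaledTail (M.ν j) (M.share Q j ω)) (Ioc a b) :=
  (((scaledTail_antitone (M.ν j) (M.share_nonneg Q j ω)).antitoneOn _).integrableOn_isCompact
    isCompact_Icc).mono_set Ioc_subset_Icc_self

theorem monotone_mixedTailFun [IsProbabilityMeasure P] (Q : Finset (Fin q)) (ω : Ω) :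
    Monotone (M.mixedTailFun Q ω) := by
  intro x y hxy
  unfold mixedTailFun
  refine mul_le_mul_of_nonneg_left (Finset.sum_le_sum fun j _ => ?_) (inv_nonneg.2
    (Finset.sum_nonneg fun j _ => mul_nonneg (mul_nonneg (M.share_nonneg Q j ω) (M.lam j).2)
      (M.mean_nonneg j)))
  refine mul_le_mul_of_nonneg_left ?_
    (mul_nonneg (M.lam j).2 (indicator_nonneg (fun _ _ => zero_le_one) ω))
  exact setIntegral_mono_set (M.integrableOn_scaledTail Q j ω 0 y)
    (Filter.Eventually.of_forall fun z => scaledTail_nonneg _ _ z)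
    (Ioc_subset_Ioc_right hxy).eventuallyLE

theorem continuous_mixedTailFun (Q : Finset (Fin q)) (ω : Ω) :
    Continuous (M.mixedTailFun Q ω) := by
  unfold mixedTailFun
  refine continuous_const.mul (continuous_finsetSum _ fun j _ => continuous_const.mul ?_)
  have h : (fun x : ℝ => ∫ y in Ioc 0 x, scaledTail (M.ν j) (M.share Q j ω) y) =
      fun x : ℝ => ∫ y in (0 : ℝ)..(max 0 x), scaledTail (M.ν j) (M.share Q j ω) y := by
    funext x
    rw [intervalIntegral.integral_of_le (le_max_left _ _)]
    rcases le_total 0 x with hx | hx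
    · rw [max_eq_right hx]
    · rw [max_eq_left hx, Ioc_eq_empty (not_lt.2 hx), Ioc_self]
  rw [h]
  exact (intervalIntegral.continuous_primitive (fun a b =>
    (scaledTail_antitone (M.ν j) (M.share_nonneg Q j ω)).intervalIntegrable) 0).comp
    (continuous_const.max continuous_id)

/-- The mixed integrated tail distribution function `F_I^Q` (a random distribution function). -/
noncomputable def mixedTail [IsProbabilityMeasure P] (Q : Finset (Fin q)) (ω : Ω) :
    StieltjesFunction ℝ where
  toFun := M.mixedTailFun Q ω
  mono' := M.monotone_mixedTailFun Q ω
  right_continuous' _ := (M.continuous_mixedTailFun Q ω).continuousWithinAt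

/-- The `n`-th term `(P^Q)^n (1 - (F_I^Q)^{n*}(x))` of the Pollaczek-Khintchine series. -/
noncomputable def pkTerm [IsProbabilityMeasure P] (Q : Finset (Fin q)) (x : ℝ) (ω : Ω)
    (n : ℕ) : ℝ :=
  M.pkParam Q ω ^ n * (1 - convPow (M.mixedTail Q ω) n x)

/-- `(1 - P^Q) ∑_{n ≥ 1} (P^Q)^n (1 - (F_I^Q)^{n*}(x))` -/
noncomputable def pkSeries [IsProbabilityMeasure P] (Q : Finset (Fin q)) (x : ℝ) (ω : Ω) : ℝ :=
  (1 - M.pkParam Q ω) * ∑' n : ℕ, M.pkTerm Q x ω (n + 1)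

/-- the event that `∑_{i ∈ Q} (R^i(t) - u^i) ≥ 0` for some `t ≥ 0` -/
def hitting (Q : Finset (Fin q)) (u : Fin q → ℝ) : Set Ω :=
  {ω | ∃ t : ℝ≥0, 0 ≤ ∑ i ∈ Q, (M.R i t ω - u i)}

end NetworkModel

section

open Filter Topology

/-! ### Independence of sequences -/

/-! Since `A` is independent of `V`, the problem reduces to deterministic coefficients `s j`. Then
`∑ j, s j * V_j` is a single compound Poisson process with drift `c = ∑ j, s j * c_j` and jump
measure `η`, the sum of the images of `λ_j ν_j` under multiplication by `s j`
(`isCompoundPoisson_weighted`). Let `m = ∫ x dη` and let `φ x` be the probability that this process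
stays at or below `x` at all dyadic times.

The core is the renewal equation `φ u = φ 0 + c⁻¹ ∫₀ᵘ φ (u - y) η(y, ∞) dy`
(`IsCompoundPoisson.renewal_eq`). On a grid of mesh `h` the process is a random walk, and its
first-step equation (`walk_first_step`) is combined with the expansion of the law of one step up to
`O(h²)` (`HasSmallTimeExpansion`). Integrating over the starting level before dividing by `h` gives
the limit without any regularity of `φ` (`renewal_of_smallTime`), and Fubini turns the generator
into the tail convolution (`generator_integral_eq`).

Letting `u → ∞` gives `l = φ 0 + l m / c` for the limit `l` of `φ`. If `m < c`, the strong law gives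
`l = 1`, so `φ 0 = 1 - m / c`, and iterating the equation gives `φ = (1 - m / c) ∑ (m / c)^n G^{n*}`
with `G` the normalized integrated tail; subtraction from the geometric series is the stated
formula. If `m ≥ c`, then `φ 0 = 0` and the equation forces `φ = 0`.

Two transfers remain. Fubini averages `φ` over the random shares (`stayProb_eq_integral_survival`).
Reaching a level at some real time and exceeding it at some dyadic time differ by a null event,
because paths are right-continuous and `φ` is left-continuous at positive levels (`hitting_ae_eq`).
-/

theorem iIndepFun_nat_of_forall_prefix {Ω β : Type*} [MeasurableSpace Ω] [MeasurableSpace β]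
    {P : Measure Ω} [IsProbabilityMeasure P] {f : ℕ → Ω → β}
    (h : ∀ (n : ℕ) (B : ℕ → Set β), (∀ i, MeasurableSet (B i)) →
      P (⋂ i ∈ Finset.range n, f i ⁻¹' B i) = ∏ i ∈ Finset.range n, P (f i ⁻¹' B i)) :
    iIndepFun f P := by
  classical
  rw [iIndepFun_iff_measure_inter_preimage_eq_mul]
  intro S B hB
  obtain ⟨n, hn⟩ : ∃ n, S ⊆ Finset.range n := S.exists_nat_subset_range
  have key := h n (fun i => if i ∈ S then B i else univ) (fun i => by
    split_ifs with hi
    · exact hB i hi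
    · exact MeasurableSet.univ)
  have h1 : (⋂ i ∈ Finset.range n, f i ⁻¹' (if i ∈ S then B i else univ)) =
      ⋂ i ∈ S, f i ⁻¹' B i := by
    ext ω
    simp only [mem_iInter, mem_preimage]
    constructor
    · intro hω i hi
      have := hω i (hn hi)
      rwa [if_pos hi] at this
    · intro hω i _
      split_ifs with hi
      · exact hω i hi
      · trivial
  rw [h1] at key
  rw [key, ← Finset.prod_subset hn]
  · exact Finset.prod_congr rfl fun i hi => by rw [if_pos hi]
  · intro i _ hi
    rw [if_neg hi, preimage_univ, measure_univ]

/-- The joint law of the array is a product over pairs, and currying carries it to the product of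
the row laws. With the two indices swapped, this turns independence of components into independence
of time steps in `IsCompoundPoisson.sum`. -/
theorem iIndepFun_curry {Ω ι κ β : Type*} [MeasurableSpace Ω] [MeasurableSpace β]
    {P : Measure Ω} [IsProbabilityMeasure P] {X : ι → κ → Ω → β}
    (mX : ∀ i j, Measurable (X i j)) (h : iIndepFun (fun (p : ι × κ) => X p.1 p.2) P) :
    iIndepFun (fun i ω j => X i j ω) P := by
  have hp : ∀ i j, IsProbabilityMeasure (P.map (X i j)) := fun i j =>
    Measure.isProbabilityMeasure_map (mX i j).aemeasurable
  have hrow : ∀ i, P.map (fun ω j => X i j ω) = Measure.infinitePi fun j => P.map (X i j) := by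
    intro i
    have : iIndepFun (X i) P := iIndepFun.precomp (g := fun j => (i, j))
      (fun a b hab => (Prod.mk.inj hab).2) h
    exact this.map_fun_eq_infinitePi_map (mX i)
  rw [iIndepFun_iff_map_fun_eq_infinitePi_map (fun i => measurable_pi_lambda _ (mX i))]
  have h2 := iIndepFun.map_fun_eq_infinitePi_map (fun p : ι × κ => mX p.1 p.2) h
  simp_rw [hrow]
  rw [← Measure.infinitePi_map_curry (fun i j => P.map (X i j)), ← h2,
    Measure.map_map (MeasurableEquiv.measurable _)
      (measurable_pi_lambda _ fun p : ι × κ => mX p.1 p.2)]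
  rfl

/-! ### Compound sums -/

/-- `∑_{k < n} x_k` -/
noncomputable def partialSum (n : ℕ) (x : ℕ → ℝ) : ℝ := ∑ k ∈ Finset.range n, x k

theorem measurable_partialSum (n : ℕ) : Measurable (partialSum n) :=
  Finset.measurable_sum _ fun k _ => measurable_pi_apply k

theorem measurable_partialSum_uncurry :
    Measurable fun p : ℕ × (ℕ → ℝ) => partialSum p.1 p.2 :=
  measurable_from_prod_countable_right measurable_partialSum

theorem infinitePi_shift (ν : Measure ℝ) [IsProbabilityMeasure ν] (a : ℕ) :
    (Measure.infinitePi fun _ : ℕ => ν).map (fun x k => x (a + k)) =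
      Measure.infinitePi fun _ : ℕ => ν :=
  Measure.map_infinitePi_infinitePi_of_inj (P := fun _ : ℕ => ν) (f := fun k => a + k)
    (fun _ _ h => Nat.add_left_cancel h)

/-- block sums of an i.i.d. sequence over consecutive blocks of lengths `m 0, m 1, …` -/
noncomputable def blockSum (m : ℕ → ℕ) (i : ℕ) (x : ℕ → ℝ) : ℝ :=
  partialSum (∑ l ∈ Finset.range (i + 1), m l) x - partialSum (∑ l ∈ Finset.range i, m l) x

theorem blockSum_eq_shift (m : ℕ → ℕ) (i : ℕ) (x : ℕ → ℝ) :
    blockSum m i x = partialSum (m i) fun k => x (∑ l ∈ Finset.range i, m l + k) := by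
  unfold blockSum partialSum
  rw [Finset.sum_range_succ, Finset.sum_range_add, add_sub_cancel_left]

theorem measurable_blockSum (m : ℕ → ℕ) (i : ℕ) : Measurable (blockSum m i) :=
  (measurable_partialSum _).sub (measurable_partialSum _)

theorem measurable_blockSum_uncurry (i : ℕ) :
    Measurable fun p : (ℕ → ℕ) × (ℕ → ℝ) => blockSum p.1 i p.2 := by
  have h : ∀ i, Measurable fun p : (ℕ → ℕ) × (ℕ → ℝ) =>
      partialSum (∑ l ∈ Finset.range i, p.1 l) p.2 := by
    intro i
    have h1 : Measurable fun p : (ℕ → ℕ) × (ℕ → ℝ) => ∑ l ∈ Finset.range i, p.1 l := by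
      fun_prop
    have h2 : Measurable fun p : (ℕ → ℕ) × (ℕ → ℝ) =>
        (∑ l ∈ Finset.range i, p.1 l, p.2) := h1.prodMk measurable_snd
    exact measurable_partialSum_uncurry.comp h2
  exact (h (i + 1)).sub (h i)

theorem measurable_blockSum_comp {Ω : Type*} [MeasurableSpace Ω] {f : Ω → ℕ → ℕ} {g : Ω → ℕ → ℝ}
    (hf : Measurable f) (hg : Measurable g) (i : ℕ) :
    Measurable fun ω => blockSum (f ω) i (g ω) :=
  by
  have h1 := hf.prodMk hg
  have h2 := measurable_blockSum_uncurry i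
  generalize hF : (fun p : (ℕ → ℕ) × (ℕ → ℝ) => blockSum p.1 i p.2) = F at h2
  have h3 : (fun ω => blockSum (f ω) i (g ω)) = fun ω => F (f ω, g ω) := by rw [← hF]
  rw [h3]
  exact h2.comp h1

/-- By induction on the number of blocks: the last block uses coordinates disjoint from those of the
earlier blocks, and shift invariance of the product measure moves it to the origin. -/
theorem infinitePi_blockSum (ν : Measure ℝ) [IsProbabilityMeasure ν] (m : ℕ → ℕ)
    (B : ℕ → Set ℝ) (hB : ∀ i, MeasurableSet (B i)) (n : ℕ) :
    (Measure.infinitePi fun _ : ℕ => ν) (⋂ i ∈ Finset.range n, blockSum m i ⁻¹' B i) =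
      ∏ i ∈ Finset.range n,
        (Measure.infinitePi fun _ : ℕ => ν) (partialSum (m i) ⁻¹' B i) := by
  classical
  set I := Measure.infinitePi fun _ : ℕ => ν with hI
  induction n with
  | zero => simp
  | succ n ih =>
    rw [Finset.prod_range_succ, ← ih]
    set a := ∑ l ∈ Finset.range n, m l with ha
    have hX : iIndepFun (fun (k : ℕ) (x : ℕ → ℝ) => x k) I :=
      iIndepFun_infinitePi (P := fun _ : ℕ => ν) (X := fun _ y => y) fun _ => measurable_id
    have hind := hX.indepFun_finset (Finset.range a) (Finset.Ico a (a + m n))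
      (by
        rw [Finset.disjoint_left]; intro k hk hk'
        rw [Finset.mem_range] at hk; rw [Finset.mem_Ico] at hk'; omega)
      (fun k => measurable_pi_apply k)
    have hsplit : (⋂ i ∈ Finset.range (n + 1), blockSum m i ⁻¹' B i) =
        (⋂ i ∈ Finset.range n, blockSum m i ⁻¹' B i) ∩ blockSum m n ⁻¹' B n := by
      rw [Finset.range_add_one]
      ext x
      simp [and_comm]
    have hshift : I (blockSum m n ⁻¹' B n) = I (partialSum (m n) ⁻¹' B n) := by
      have h1 : blockSum m n ⁻¹' B n =
          (fun (x : ℕ → ℝ) k => x (a + k)) ⁻¹' (partialSum (m n) ⁻¹' B n) := by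
        ext x
        simp only [mem_preimage, blockSum_eq_shift, ha]
      rw [h1, ← Measure.map_apply (by fun_prop) (measurable_partialSum _ (hB n)), hI,
        infinitePi_shift]
    rw [hsplit, ← hshift]
    have hmono : ∀ i ≤ n, ∑ l ∈ Finset.range i, m l ≤ a := fun i hi =>
      Finset.sum_le_sum_of_subset (Finset.range_subset_range.2 hi)
    -- extension by zero of a restricted sequence
    let e : (S : Finset ℕ) → (S → ℝ) → ℕ → ℝ := fun S y k => if h : k ∈ S then y ⟨k, h⟩ else 0
    have he : ∀ S, Measurable (e S) := by
      intro S
      refine measurable_pi_lambda _ fun k => ?_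
      by_cases h : k ∈ S
      · simp only [e, h, dif_pos]; exact measurable_pi_apply _
      · simp only [e, h, dif_neg, not_false_eq_true]; exact measurable_const
    -- Independence of disjoint coordinate sets speaks of restricted sequences; block sums ignore
    -- the remaining coordinates, so extending by zero changes nothing.
    have hl : (⋂ i ∈ Finset.range n, blockSum m i ⁻¹' B i) =
        (fun (x : ℕ → ℝ) (k : Finset.range a) => x k) ⁻¹'
          ((e (Finset.range a)) ⁻¹' ⋂ i ∈ Finset.range n, blockSum m i ⁻¹' B i) := by
      ext x
      simp only [mem_iInter, mem_preimage]
      refine forall₂_congr fun i hi => ?_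
      have hi' := Finset.mem_range.1 hi
      have : blockSum m i (e (Finset.range a) fun k : Finset.range a => x k) = blockSum m i x := by
        unfold blockSum partialSum
        congr 1
        · refine Finset.sum_congr rfl fun k hk => ?_
          have : k ∈ Finset.range a :=
            Finset.mem_range.2 ((Finset.mem_range.1 hk).trans_le (hmono (i + 1) hi'))
          simp only [e, dif_pos this]
        · refine Finset.sum_congr rfl fun k hk => ?_
          have : k ∈ Finset.range a :=
            Finset.mem_range.2 ((Finset.mem_range.1 hk).trans_le (hmono i hi'.le))
          simp only [e, dif_pos this]
      rw [this]
    have hr : blockSum m n ⁻¹' B n =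
        (fun (x : ℕ → ℝ) (k : Finset.Ico a (a + m n)) => x k) ⁻¹'
          ((e (Finset.Ico a (a + m n))) ⁻¹' (blockSum m n ⁻¹' B n)) := by
      ext x
      simp only [mem_preimage]
      have : blockSum m n (e (Finset.Ico a (a + m n)) fun k : Finset.Ico a (a + m n) => x k) =
          blockSum m n x := by
        rw [blockSum_eq_shift, blockSum_eq_shift]
        unfold partialSum
        refine Finset.sum_congr rfl fun k hk => ?_
        have : a + k ∈ Finset.Ico a (a + m n) := by
          rw [Finset.mem_range] at hk; rw [Finset.mem_Ico]; omega
        simp only [e, ← ha, dif_pos this]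
      rw [this]
    rw [hl, hr]
    refine hind.measure_inter_preimage_eq_mul _ _ (he _ ?_) (he _ (measurable_blockSum m n (hB n)))
    exact Finset.measurableSet_biInter _ fun i _ => measurable_blockSum m i (hB i)

/-- Block sums of an i.i.d. sequence over independent blocks of random i.i.d. lengths. -/
theorem measure_iInter_blockSum {Ω : Type*} [MeasurableSpace Ω] {P : Measure Ω}
    [IsProbabilityMeasure P] {D : ℕ → Ω → ℕ} {X : ℕ → Ω → ℝ} {π : Measure ℕ} {ν : Measure ℝ}
    [IsProbabilityMeasure ν]
    (hD : iIndepFun D P) (mD : ∀ i, Measurable (D i)) (hπ : ∀ i, P.map (D i) = π)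
    (hX : iIndepFun X P) (mX : ∀ k, Measurable (X k)) (hν : ∀ k, P.map (X k) = ν)
    (hDX : IndepFun (fun ω i => D i ω) (fun ω k => X k ω) P)
    (n : ℕ) (B : ℕ → Set ℝ) (hB : ∀ i, MeasurableSet (B i)) :
    P (⋂ i ∈ Finset.range n, {ω | blockSum (fun l => D l ω) i (fun k => X k ω) ∈ B i}) =
      ∏ i ∈ Finset.range n,
        ∫⁻ m, (Measure.infinitePi fun _ : ℕ => ν) (partialSum m ⁻¹' B i) ∂π := by
  have mD' : Measurable fun ω i => D i ω := measurable_pi_lambda _ mD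
  have mX' : Measurable fun ω k => X k ω := measurable_pi_lambda _ mX
  have hlaw := (indepFun_iff_map_prod_eq_prod_map_map mD'.aemeasurable mX'.aemeasurable).1 hDX
  have hXlaw : P.map (fun ω k => X k ω) = Measure.infinitePi fun _ : ℕ => ν := by
    rw [hX.map_fun_eq_infinitePi_map mX]; simp_rw [hν]
  have hE : MeasurableSet (⋂ i ∈ Finset.range n,
      {p : (ℕ → ℕ) × (ℕ → ℝ) | blockSum p.1 i p.2 ∈ B i}) :=
    Finset.measurableSet_biInter _ fun i _ => measurable_blockSum_uncurry i (hB i)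
  have h1 : (⋂ i ∈ Finset.range n, {ω | blockSum (fun l => D l ω) i (fun k => X k ω) ∈ B i}) =
      (fun ω => ((fun i => D i ω), (fun k => X k ω))) ⁻¹' (⋂ i ∈ Finset.range n,
        {p : (ℕ → ℕ) × (ℕ → ℝ) | blockSum p.1 i p.2 ∈ B i}) := by
    ext ω; simp
  -- With the lengths frozen the probability factorizes over blocks; each factor depends on one
  -- length only, so independence of the lengths factorizes the outer integral.
  rw [h1, ← Measure.map_apply (mD'.prodMk mX') hE, hlaw, hXlaw, Measure.prod_apply hE]
  have h2 : ∀ m : ℕ → ℕ, Prod.mk m ⁻¹' (⋂ i ∈ Finset.range n,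
        {p : (ℕ → ℕ) × (ℕ → ℝ) | blockSum p.1 i p.2 ∈ B i}) =
      ⋂ i ∈ Finset.range n, blockSum m i ⁻¹' B i := by
    intro m; ext x; simp
  simp_rw [h2, infinitePi_blockSum ν _ B hB]
  have mprod : Measurable fun m : ℕ → ℕ => ∏ i ∈ Finset.range n,
      (Measure.infinitePi fun _ : ℕ => ν) (partialSum (m i) ⁻¹' B i) :=
    Finset.measurable_prod _ fun i _ =>
      (measurable_from_nat (f := fun m => (Measure.infinitePi fun _ : ℕ => ν)
        (partialSum m ⁻¹' B i))).comp (measurable_pi_apply i)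
  rw [lintegral_map mprod mD']
  have h3 : iIndepFun (fun i ω => (Measure.infinitePi fun _ : ℕ => ν)
      (partialSum (D i ω) ⁻¹' B i)) P :=
    hD.comp (fun i m => (Measure.infinitePi fun _ : ℕ => ν) (partialSum m ⁻¹' B i))
      fun i => measurable_from_nat
  rw [lintegral_prod_eq_prod_lintegral_of_indepFun _ _ h3 fun i => (measurable_from_nat (f := fun m =>
      (Measure.infinitePi fun _ : ℕ => ν) (partialSum m ⁻¹' B i))).comp (mD i)]
  refine Finset.prod_congr rfl fun i _ => ?_
  rw [← hπ i, lintegral_map measurable_from_nat (mD i)]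

/-- the law of a sum of i.i.d. summands with law `ν`, whose number has law `π` -/
noncomputable def compoundLaw (π : Measure ℕ) (ν : Measure ℝ) : Measure ℝ :=
  (π.prod (Measure.infinitePi fun _ : ℕ => ν)).map fun p => partialSum p.1 p.2

instance (π : Measure ℕ) (ν : Measure ℝ) [IsProbabilityMeasure π] [IsProbabilityMeasure ν] :
    IsProbabilityMeasure (compoundLaw π ν) :=
  Measure.isProbabilityMeasure_map measurable_partialSum_uncurry.aemeasurable

theorem compoundLaw_apply (π : Measure ℕ) (ν : Measure ℝ) [IsProbabilityMeasure π]
    [IsProbabilityMeasure ν] {B : Set ℝ} (hB : MeasurableSet B) :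
    compoundLaw π ν B =
      ∫⁻ m, (Measure.infinitePi fun _ : ℕ => ν) (partialSum m ⁻¹' B) ∂π := by
  rw [compoundLaw, Measure.map_apply measurable_partialSum_uncurry hB,
    Measure.prod_apply (measurable_partialSum_uncurry hB)]
  rfl

theorem map_blockSum_eq_compoundLaw {Ω : Type*} [MeasurableSpace Ω] {P : Measure Ω}
    [IsProbabilityMeasure P] {D : ℕ → Ω → ℕ} {X : ℕ → Ω → ℝ} {π : Measure ℕ} {ν : Measure ℝ}
    [IsProbabilityMeasure π] [IsProbabilityMeasure ν]
    (hD : iIndepFun D P) (mD : ∀ i, Measurable (D i)) (hπ : ∀ i, P.map (D i) = π)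
    (hX : iIndepFun X P) (mX : ∀ k, Measurable (X k)) (hν : ∀ k, P.map (X k) = ν)
    (hDX : IndepFun (fun ω i => D i ω) (fun ω k => X k ω) P) (i : ℕ) :
    P.map (fun ω => blockSum (fun l => D l ω) i (fun k => X k ω)) = compoundLaw π ν := by
  classical
  have mD' : Measurable fun ω i => D i ω := measurable_pi_lambda _ mD
  have mX' : Measurable fun ω k => X k ω := measurable_pi_lambda _ mX
  have mB : Measurable fun ω => blockSum (fun l => D l ω) i (fun k => X k ω) :=
    measurable_blockSum_comp mD' mX' i
  ext B hB
  rw [compoundLaw_apply π ν hB]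
  have := measure_iInter_blockSum hD mD hπ hX mX hν hDX (i + 1)
    (fun l => if l = i then B else univ) (fun l => by split_ifs <;> measurability)
  rw [Finset.prod_eq_single i] at this
  · rw [if_pos rfl] at this
    rw [← this, Measure.map_apply mB hB]
    congr 1
    ext ω
    simp only [mem_preimage, mem_iInter, mem_ofPred_eq, Finset.mem_range]
    constructor
    · intro h l _
      split_ifs with hl
      · rw [hl]; exact h
      · trivial
    · intro h
      simpa using h i (Nat.lt_succ_self i)
  · intro l _ hl
    simp [if_neg hl]
  · intro h
    simp at h

theorem iIndepFun_blockSum {Ω : Type*} [MeasurableSpace Ω] {P : Measure Ω}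
    [IsProbabilityMeasure P] {D : ℕ → Ω → ℕ} {X : ℕ → Ω → ℝ} {π : Measure ℕ} {ν : Measure ℝ}
    [IsProbabilityMeasure π] [IsProbabilityMeasure ν]
    (hD : iIndepFun D P) (mD : ∀ i, Measurable (D i)) (hπ : ∀ i, P.map (D i) = π)
    (hX : iIndepFun X P) (mX : ∀ k, Measurable (X k)) (hν : ∀ k, P.map (X k) = ν)
    (hDX : IndepFun (fun ω i => D i ω) (fun ω k => X k ω) P) :
    iIndepFun (fun i ω => blockSum (fun l => D l ω) i (fun k => X k ω)) P := by
  have mD' : Measurable fun ω i => D i ω := measurable_pi_lambda _ mD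
  have mX' : Measurable fun ω k => X k ω := measurable_pi_lambda _ mX
  refine iIndepFun_nat_of_forall_prefix fun n B hB => ?_
  have := measure_iInter_blockSum hD mD hπ hX mX hν hDX n B hB
  simp_rw [← compoundLaw_apply π ν (hB _)] at this
  refine this.trans (Finset.prod_congr rfl fun i _ => ?_)
  rw [← map_blockSum_eq_compoundLaw hD mD hπ hX mX hν hDX i, Measure.map_apply (measurable_blockSum_comp mD' mX' i) (hB i)]

/-! ### Poisson weights -/

/-- The weights at `0` and `1` differ from `1 - r` and `r` by at most `r ^ 2`, and the mass from `2`
on is `1 - (1 + r) e^{-r} ≤ r ^ 2`; these are the three contributions. -/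
theorem tsum_poisson_tail_le {r : ℝ} (hr : 0 ≤ r) (g : ℕ → ℝ) (hg : ∀ n, |g n| ≤ 1)
    {w : ℕ → ℝ} (hw : ∀ n, 0 ≤ w n) (hw0 : w 0 = Real.exp (-r)) (hw1 : w 1 = Real.exp (-r) * r)
    (hsum : HasSum w 1) :
    |∑' n, w n * g n - ((1 - r) * g 0 + r * g 1)| ≤ 3 * r ^ 2 := by
  have hs : Summable fun n => w n * g n :=
    Summable.of_norm_bounded hsum.summable fun n => by
      rw [Real.norm_eq_abs, abs_mul, abs_of_nonneg (hw n)]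
      exact mul_le_of_le_one_right (hw n) (hg n)
  rw [← hs.sum_add_tsum_nat_add 2]
  have htail : HasSum (fun n => w (n + 2)) (1 - ∑ i ∈ Finset.range 2, w i) :=
    (hasSum_nat_add_iff' 2).2 hsum
  have hrem : |∑' n, w (n + 2) * g (n + 2)| ≤ 1 - ∑ i ∈ Finset.range 2, w i := by
    rw [← Real.norm_eq_abs]
    refine tsum_of_norm_bounded htail fun n => ?_
    rw [Real.norm_eq_abs, abs_mul, abs_of_nonneg (hw _)]
    exact mul_le_of_le_one_right (hw _) (hg _)
  simp only [Finset.sum_range_succ, Finset.sum_range_zero, zero_add, hw0, hw1] at hrem ⊢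
  have e1 : 1 - r ≤ Real.exp (-r) := by have := Real.add_one_le_exp (-r); linarith
  have e2 : Real.exp (-r) ≤ 1 - r + r ^ 2 := by
    have h1 : (1 + r) * Real.exp (-r) ≤ 1 := by
      have h3 : 1 + r ≤ Real.exp r := by have := Real.add_one_le_exp r; linarith
      calc (1 + r) * Real.exp (-r) ≤ Real.exp r * Real.exp (-r) := by gcongr
        _ = 1 := by rw [← Real.exp_add]; simp
    have h2 : 1 ≤ (1 + r) * (1 - r + r ^ 2) := by nlinarith [pow_nonneg hr 3]
    exact le_of_mul_le_mul_left (h1.trans h2) (by linarith)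
  have a0 : |(Real.exp (-r) - (1 - r)) * g 0| ≤ r ^ 2 := by
    rw [abs_mul, abs_of_nonneg (by linarith)]
    nlinarith [hg 0, abs_nonneg (g 0)]
  have a1 : |(Real.exp (-r) * r - r) * g 1| ≤ r ^ 2 := by
    have : Real.exp (-r) * r - r ≤ 0 := by
      have : Real.exp (-r) ≤ 1 := Real.exp_le_one_iff.2 (by linarith)
      nlinarith
    have h3 : r - Real.exp (-r) * r ≤ r ^ 2 := by nlinarith
    rw [abs_mul, abs_of_nonpos this]
    nlinarith [hg 1, abs_nonneg (g 1)]
  have a2 : |∑' n, w (n + 2) * g (n + 2)| ≤ r ^ 2 := hrem.trans (by nlinarith)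
  rw [abs_le] at *
  constructor <;> nlinarith [a0.1, a0.2, a1.1, a1.2, a2.1, a2.2]

theorem hasSum_poisson_mean (r : ℝ≥0) :
    HasSum (fun n : ℕ => Real.exp (-r) * r ^ n / n.factorial * (n : ℝ)) r := by
  rw [← hasSum_nat_add_iff' 1]
  simp only [Finset.range_one, Finset.sum_singleton, Nat.cast_zero, mul_zero, sub_zero]
  have h := (hasSum_one_poissonMeasure r).mul_left (r : ℝ)
  rw [mul_one] at h
  refine h.congr_fun fun n => ?_
  rw [Nat.factorial_succ]
  push_cast
  field_simp
  ring

theorem integrable_natCast_poissonMeasure (r : ℝ≥0) :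
    Integrable (fun n : ℕ => (n : ℝ)) (poissonMeasure r) := by
  rw [integrable_poissonMeasure_iff]
  simpa using (hasSum_poisson_mean r).summable

theorem integral_natCast_poissonMeasure (r : ℝ≥0) : ∫ n : ℕ, (n : ℝ) ∂(poissonMeasure r) = r := by
  rw [integral_poissonMeasure]
  simpa using (hasSum_poisson_mean r).tsum_eq

/-! ### Moments and small-time expansion of compound Poisson laws -/

theorem integral_compoundLaw {π : Measure ℕ} {ν : Measure ℝ} [IsProbabilityMeasure π]
    [IsProbabilityMeasure ν] {f : ℝ → ℝ} (hf : Measurable f)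
    (hi : Integrable f (compoundLaw π ν)) :
    ∫ x, f x ∂(compoundLaw π ν) =
      ∫ m, ∫ x, f (partialSum m x) ∂(Measure.infinitePi fun _ : ℕ => ν) ∂π := by
  rw [compoundLaw, integrable_map_measure hf.aestronglyMeasurable
    measurable_partialSum_uncurry.aemeasurable] at hi
  rw [compoundLaw, integral_map measurable_partialSum_uncurry.aemeasurable
    hf.aestronglyMeasurable]
  exact integral_prod _ hi

theorem integrable_eval_infinitePi {ν : Measure ℝ} [IsProbabilityMeasure ν]
    (hν : Integrable (fun x : ℝ => x) ν) (k : ℕ) :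
    Integrable (fun x : ℕ → ℝ => x k) (Measure.infinitePi fun _ : ℕ => ν) := by
  rw [← Measure.infinitePi_map_eval (fun _ : ℕ => ν) k] at hν
  exact hν.comp_measurable (measurable_pi_apply k)

theorem integral_eval_infinitePi {ν : Measure ℝ} [IsProbabilityMeasure ν] {f : ℝ → ℝ}
    (hf : Measurable f) (k : ℕ) :
    ∫ x : ℕ → ℝ, f (x k) ∂(Measure.infinitePi fun _ : ℕ => ν) = ∫ x, f x ∂ν := by
  rw [← Measure.infinitePi_map_eval (fun _ : ℕ => ν) k,
    integral_map (measurable_pi_apply k).aemeasurable hf.aestronglyMeasurable,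
    Measure.infinitePi_map_eval]

theorem integrable_partialSum {ν : Measure ℝ} [IsProbabilityMeasure ν]
    (hν : Integrable (fun x : ℝ => x) ν) (m : ℕ) :
    Integrable (partialSum m) (Measure.infinitePi fun _ : ℕ => ν) :=
  integrable_finsetSum _ fun k _ => integrable_eval_infinitePi hν k

theorem integrable_compoundLaw_poisson (r : ℝ≥0) {ν : Measure ℝ} [IsProbabilityMeasure ν]
    (hν : Integrable (fun x : ℝ => x) ν) :
    Integrable (fun x : ℝ => x) (compoundLaw (poissonMeasure r) ν) := by
  rw [compoundLaw, integrable_map_measure measurable_id'.aestronglyMeasurable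
    measurable_partialSum_uncurry.aemeasurable,
    integrable_prod_iff (measurable_id'.comp measurable_partialSum_uncurry).aestronglyMeasurable]
  refine ⟨Filter.Eventually.of_forall fun m => integrable_partialSum hν m, ?_⟩
  refine ((integrable_natCast_poissonMeasure r).mul_const (∫ x, |x| ∂ν)).mono'
    measurable_from_nat.aestronglyMeasurable (Filter.Eventually.of_forall fun m => ?_)
  rw [Real.norm_eq_abs, abs_of_nonneg (integral_nonneg fun x => norm_nonneg _)]
  simp only [Function.comp]
  calc ∫ y, ‖partialSum m y‖ ∂(Measure.infinitePi fun _ : ℕ => ν)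
      ≤ ∫ y, ∑ k ∈ Finset.range m, |y k| ∂(Measure.infinitePi fun _ : ℕ => ν) :=
        integral_mono (integrable_partialSum hν m).norm
          (integrable_finsetSum _ fun k _ => (integrable_eval_infinitePi hν k).abs)
          fun y => Finset.abs_sum_le_sum_abs _ _
    _ = m * ∫ x, |x| ∂ν := by
        rw [integral_finsetSum _ fun k _ => (integrable_eval_infinitePi hν k).abs]
        simp_rw [integral_eval_infinitePi (ν := ν) (f := fun x => |x|) measurable_norm]
        simp

theorem integral_compoundLaw_poisson (r : ℝ≥0) {ν : Measure ℝ} [IsProbabilityMeasure ν]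
    (hν : Integrable (fun x : ℝ => x) ν) :
    ∫ x, x ∂(compoundLaw (poissonMeasure r) ν) = r * ∫ x, x ∂ν := by
  rw [integral_compoundLaw measurable_id' (integrable_compoundLaw_poisson r hν)]
  have : ∀ m, ∫ x, partialSum m x ∂(Measure.infinitePi fun _ : ℕ => ν) = m * ∫ x, x ∂ν := by
    intro m
    unfold partialSum
    rw [integral_finsetSum _ fun k _ => integrable_eval_infinitePi hν k]
    simp_rw [integral_eval_infinitePi (ν := ν) (f := fun x => x) measurable_id']
    simp
  simp_rw [this]
  rw [integral_mul_const, integral_natCast_poissonMeasure]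

/-- The probability measures `κ h` have the small-time expansion
`κ h = (1 - h η(ℝ)) δ₀ + h η + O(h ^ 2)` in total variation. -/
def HasSmallTimeExpansion (κ : ℝ≥0 → Measure ℝ) (η : Measure ℝ) : Prop :=
  ∃ C : ℝ, 0 ≤ C ∧ ∀ h : ℝ≥0, h ≤ 1 → ∀ f : ℝ → ℝ, Measurable f → (∀ x, |f x| ≤ 1) →
    |∫ x, f x ∂(κ h) - ((1 - h * η.real univ) * f 0 + h * ∫ x, f x ∂η)| ≤ C * (h : ℝ) ^ 2

theorem integrable_of_abs_le_one {μ : Measure ℝ} [IsFiniteMeasure μ] {f : ℝ → ℝ}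
    (hf : Measurable f) (h : ∀ x, |f x| ≤ 1) : Integrable f μ :=
  Integrable.of_bound hf.aestronglyMeasurable 1 (Filter.Eventually.of_forall h)

/-- Conditioning on the number of jumps: no jump contributes `f 0`, one jump contributes `∫ f dν`,
and the Poisson estimate absorbs the rest. -/
theorem hasSmallTimeExpansion_compoundLaw (lam : ℝ≥0) (ν : Measure ℝ) [IsProbabilityMeasure ν] :
    HasSmallTimeExpansion (fun h => compoundLaw (poissonMeasure (lam * h)) ν) (lam • ν) := by
  refine ⟨3 * (lam : ℝ) ^ 2, by positivity, fun h _ f hf hf1 => ?_⟩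
  rw [integral_compoundLaw hf (integrable_of_abs_le_one hf hf1), integral_poissonMeasure]
  have key := tsum_poisson_tail_le (r := (lam * h : ℝ≥0)) (NNReal.coe_nonneg _)
    (fun m => ∫ x, f (partialSum m x) ∂(Measure.infinitePi fun _ : ℕ => ν))
    (fun m => by
      have := norm_integral_le_of_norm_le_const (μ := Measure.infinitePi fun _ : ℕ => ν)
        (f := fun x => f (partialSum m x)) (C := 1) (Filter.Eventually.of_forall fun x => hf1 _)
      simpa using this)
    (w := fun n => Real.exp (-(lam * h : ℝ≥0)) * ((lam * h : ℝ≥0) : ℝ) ^ n / n.factorial)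
    (fun n => by positivity) (by simp) (by simp) (hasSum_one_poissonMeasure _)
  have h0 : ∫ x, f (partialSum 0 x) ∂(Measure.infinitePi fun _ : ℕ => ν) = f 0 := by
    simp [partialSum]
  have h1 : ∫ x, f (partialSum 1 x) ∂(Measure.infinitePi fun _ : ℕ => ν) = ∫ x, f x ∂ν := by
    simp only [partialSum, Finset.sum_range_one]
    exact integral_eval_infinitePi hf 0
  simp only [h0, h1] at key
  rw [integral_smul_nnreal_measure, measureReal_nnreal_smul_apply]
  simp only [smul_eq_mul, probReal_univ, NNReal.smul_def] at key ⊢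
  push_cast at key ⊢
  refine le_trans (le_of_eq ?_) (key.trans (le_of_eq ?_))
  · congr 1; ring
  · ring

theorem HasSmallTimeExpansion.map_mul {κ : ℝ≥0 → Measure ℝ} {η : Measure ℝ}
    (h : HasSmallTimeExpansion κ η) (s : ℝ) :
    HasSmallTimeExpansion (fun h => (κ h).map (s * ·)) (η.map (s * ·)) := by
  obtain ⟨C, hC, H⟩ := h
  refine ⟨C, hC, fun h hh f hf hf1 => ?_⟩
  have ms : Measurable fun x : ℝ => s * x := measurable_const_mul s
  have := H h hh (fun x => f (s * x)) (hf.comp ms) fun x => hf1 _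
  rw [integral_map ms.aemeasurable hf.aestronglyMeasurable,
    integral_map ms.aemeasurable hf.aestronglyMeasurable,
    map_measureReal_apply ms MeasurableSet.univ, preimage_univ]
  simpa using this

theorem hasSmallTimeExpansion_dirac :
    HasSmallTimeExpansion (fun _ => Measure.dirac 0) 0 :=
  ⟨0, le_rfl, fun h _ f _ _ => by simp⟩

/-- The inner integral is expanded by means of `κ'` and the results by means of `κ`. Products of two
first-order terms are `O(h²)` since both jump measures are finite, so only the sum of the
first-order terms survives. -/
theorem HasSmallTimeExpansion.conv {κ κ' : ℝ≥0 → Measure ℝ} {η η' : Measure ℝ}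
    [IsFiniteMeasure η] [IsFiniteMeasure η'] [∀ h, IsProbabilityMeasure (κ h)]
    [∀ h, IsProbabilityMeasure (κ' h)]
    (H : HasSmallTimeExpansion κ η) (H' : HasSmallTimeExpansion κ' η') :
    HasSmallTimeExpansion (fun h => (κ h).conv (κ' h)) (η + η') := by
  obtain ⟨C, hC, H⟩ := H
  obtain ⟨C', hC', H'⟩ := H'
  set a := η.real univ with ha
  set a' := η'.real univ with ha'
  have ha0 : 0 ≤ a := measureReal_nonneg
  have ha'0 : 0 ≤ a' := measureReal_nonneg
  -- the expansion extends to bounded functions by homogeneity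
  have Hb : ∀ h : ℝ≥0, h ≤ 1 → ∀ f : ℝ → ℝ, Measurable f → ∀ K : ℝ, 0 ≤ K → (∀ x, |f x| ≤ K) →
      |∫ x, f x ∂(κ h) - ((1 - h * a) * f 0 + h * ∫ x, f x ∂η)| ≤ K * (C * (h : ℝ) ^ 2) := by
    intro h hh f hf K hK hfK
    rcases hK.eq_or_lt with rfl | hK
    · have : f = fun _ => 0 := funext fun x => abs_eq_zero.1 (le_antisymm (hfK x) (abs_nonneg _))
      simp [this]
    · have := H h hh (fun x => K⁻¹ * f x) (hf.const_mul _) fun x => by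
        rw [abs_mul, abs_of_pos (inv_pos.2 hK), inv_mul_le_iff₀ hK, mul_one]; exact hfK x
      rw [integral_const_mul, integral_const_mul] at this
      have e : K⁻¹ * ∫ x, f x ∂(κ h) - ((1 - h * a) * (K⁻¹ * f 0) + h * (K⁻¹ * ∫ x, f x ∂η)) =
        K⁻¹ * (∫ x, f x ∂(κ h) - ((1 - h * a) * f 0 + h * ∫ x, f x ∂η)) := by ring
      rw [e, abs_mul, abs_of_pos (inv_pos.2 hK), inv_mul_le_iff₀ hK] at this
      exact this
  -- The summands of the constant are the expansion errors of `κ'` and `κ`, then the costs of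
  -- replacing `J` by `f 0` (`c1`) and `L` by `A'` (`c2`) in terms that already carry a factor `h`.
  refine ⟨C' + C + a' * (2 * a + C) + (2 * a * a' + a' * C), by positivity, fun h hh f hf hf1 => ?_⟩
  have hh1 : (h : ℝ) ≤ 1 := hh
  have hh0 : (0 : ℝ) ≤ h := h.2
  rw [integral_conv (integrable_of_abs_le_one hf hf1),
    integral_add_measure (integrable_of_abs_le_one hf hf1) (integrable_of_abs_le_one hf hf1),
    measureReal_add_apply]
  -- the two functions of the first variable
  have madd : Measurable fun p : ℝ × ℝ => f (p.1 + p.2) :=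
    hf.comp (measurable_fst.add measurable_snd)
  have mg : Measurable fun x => ∫ y, f (x + y) ∂(κ' h) :=
    madd.stronglyMeasurable.integral_prod_right.measurable
  have mf1 : Measurable fun x => ∫ y, f (x + y) ∂η' :=
    madd.stronglyMeasurable.integral_prod_right.measurable
  have bg : ∀ x, |∫ y, f (x + y) ∂(κ' h)| ≤ 1 := fun x => by
    have := norm_integral_le_of_norm_le_const (μ := κ' h) (f := fun y => f (x + y)) (C := 1)
      (Filter.Eventually.of_forall fun y => hf1 _)
    simpa using this
  have bf1 : ∀ x, |∫ y, f (x + y) ∂η'| ≤ a' := fun x => by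
    have := norm_integral_le_of_norm_le_const (μ := η') (f := fun y => f (x + y)) (C := 1)
      (Filter.Eventually.of_forall fun y => hf1 _)
    simpa [ha'] using this
  have if1 : Integrable (fun x => ∫ y, f (x + y) ∂η') (κ h) :=
    Integrable.of_bound mf1.aestronglyMeasurable a' (Filter.Eventually.of_forall bf1)
  have ifx : Integrable f (κ h) := integrable_of_abs_le_one hf hf1
  have s1 : |∫ x, ∫ y, f (x + y) ∂(κ' h) ∂(κ h) -
      ((1 - h * a') * ∫ x, f x ∂(κ h) + h * ∫ x, ∫ y, f (x + y) ∂η' ∂(κ h))| ≤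
      C' * (h : ℝ) ^ 2 := by
    have e : (1 - h * a') * ∫ x, f x ∂(κ h) + h * ∫ x, ∫ y, f (x + y) ∂η' ∂(κ h) =
        ∫ x, ((1 - h * a') * f x + h * ∫ y, f (x + y) ∂η') ∂(κ h) := by
      rw [integral_add (ifx.const_mul _) (if1.const_mul _), integral_const_mul,
        integral_const_mul]
    have i2 : Integrable (fun x => (1 - h * a') * f x + h * ∫ y, f (x + y) ∂η') (κ h) :=
      (ifx.const_mul _).add (if1.const_mul _)
    rw [e, ← integral_sub (integrable_of_abs_le_one mg bg) i2]
    have := norm_integral_le_of_norm_le_const (μ := κ h)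
      (f := fun x => ∫ y, f (x + y) ∂(κ' h) -
        ((1 - h * a') * f x + h * ∫ y, f (x + y) ∂η')) (C := C' * (h : ℝ) ^ 2)
      (Filter.Eventually.of_forall fun x => by
        have := H' h hh (fun y => f (x + y)) (hf.comp (measurable_const_add x)) fun y => hf1 _
        simpa using this)
    simpa using this
  have s2 := H h hh f hf hf1
  have s3 := Hb h hh _ mf1 a' ha'0 bf1
  simp only [zero_add] at s3
  set I := ∫ x, ∫ y, f (x + y) ∂(κ' h) ∂(κ h)
  set J := ∫ x, f x ∂(κ h)
  set L := ∫ x, ∫ y, f (x + y) ∂η' ∂(κ h)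
  set T := ∫ x, ∫ y, f (x + y) ∂η' ∂η
  set A := ∫ x, f x ∂η
  set A' := ∫ x, f x ∂η'
  have bA : |A| ≤ a := by
    have := norm_integral_le_of_norm_le_const (μ := η) (f := f) (C := 1)
      (Filter.Eventually.of_forall fun y => hf1 _)
    simpa [ha] using this
  have bA' : |A'| ≤ a' := by simpa using bf1 0
  have bT : |T| ≤ a' * a := by
    have := norm_integral_le_of_norm_le_const (μ := η) (f := fun x => ∫ y, f (x + y) ∂η') (C := a')
      (Filter.Eventually.of_forall fun y => bf1 _)
    simpa [ha] using this
  have hsq : (h : ℝ) ^ 2 ≤ h := by nlinarith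
  have b1 : |h * a * f 0| ≤ h * a := by
    rw [abs_mul, abs_of_nonneg (by positivity)]
    exact mul_le_of_le_one_right (by positivity) (hf1 0)
  have b2 : |h * A| ≤ h * a := by
    rw [abs_mul, abs_of_nonneg hh0]; gcongr
  have bJ : |J - f 0| ≤ h * (2 * a + C) := by
    have e : J - f 0 = (J - ((1 - h * a) * f 0 + h * A)) - h * a * f 0 + h * A := by ring
    rw [e]
    refine (abs_add_le _ _).trans ?_
    refine (add_le_add_left (abs_sub _ _) _).trans ?_
    have : C * (h : ℝ) ^ 2 ≤ C * h := by gcongr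
    linarith
  have c1 : |h * a' * (J - f 0)| ≤ a' * (2 * a + C) * (h : ℝ) ^ 2 := by
    rw [abs_mul, abs_of_nonneg (by positivity)]
    calc h * a' * |J - f 0| ≤ h * a' * (h * (2 * a + C)) := by gcongr
      _ = _ := by ring
  have bL : |L - A'| ≤ h * (2 * a * a' + a' * C) := by
    have e : L - A' = (L - ((1 - h * a) * A' + h * T)) - h * (a * A') + h * T := by ring
    have d1 : |h * (a * A')| ≤ h * (a * a') := by
      rw [abs_mul, abs_mul, abs_of_nonneg hh0, abs_of_nonneg ha0]; gcongr
    have d2 : |h * T| ≤ h * (a' * a) := by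
      rw [abs_mul, abs_of_nonneg hh0]; gcongr
    rw [e]
    refine (abs_add_le _ _).trans ?_
    refine (add_le_add_left (abs_sub _ _) _).trans ?_
    have : a' * (C * (h : ℝ) ^ 2) ≤ a' * (C * h) := by gcongr
    linarith
  have c2 : |h * (L - A')| ≤ (2 * a * a' + a' * C) * (h : ℝ) ^ 2 := by
    rw [abs_mul, abs_of_nonneg hh0]
    calc h * |L - A'| ≤ h * (h * (2 * a * a' + a' * C)) := by gcongr
      _ = _ := by ring
  have e : I - ((1 - h * (a + a')) * f 0 + h * (A + A')) =
      (I - ((1 - h * a') * J + h * L)) + (J - ((1 - h * a) * f 0 + h * A)) -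
        h * a' * (J - f 0) + h * (L - A') := by ring
  rw [e]
  refine (abs_add_le _ _).trans ?_
  refine (add_le_add_left (abs_sub _ _) _).trans ?_
  have := abs_add_le (I - ((1 - h * a') * J + h * L)) (J - ((1 - h * a) * f 0 + h * A))
  linarith

/-! ### Convolution with the integrated tail of a finite measure -/

/-- convolution of `f` with the tail function `y ↦ η (y, ∞)` on `(0, ∞)` -/
noncomputable def tailConv (η : Measure ℝ) (f : ℝ → ℝ) (u : ℝ) : ℝ :=
  ∫ y in Ioi 0, f (u - y) * η.real (Ioi y)

theorem antitone_tail (η : Measure ℝ) [IsFiniteMeasure η] : Antitone fun y => η.real (Ioi y) :=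
  fun _ _ h => measureReal_mono (Ioi_subset_Ioi h)

theorem integrable_mul_tail {η : Measure ℝ} [IsFiniteMeasure η]
    (hI : IntegrableOn (fun y => η.real (Ioi y)) (Ioi 0)) {f : ℝ → ℝ} (hf : Measurable f) {K : ℝ}
    (hK : ∀ x, |f x| ≤ K) (u : ℝ) :
    IntegrableOn (fun y => f (u - y) * η.real (Ioi y)) (Ioi 0) := by
  refine Integrable.mono' (hI.const_mul K)
    ((hf.comp (measurable_const_sub u)).mul (antitone_tail η).measurable).aestronglyMeasurable
    (Eventually.of_forall fun y => ?_)
  rw [Real.norm_eq_abs, abs_mul, abs_of_nonneg (measureReal_nonneg (μ := η))]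
  exact mul_le_mul_of_nonneg_right (hK _) measureReal_nonneg

theorem measurable_tailConv {η : Measure ℝ} [IsFiniteMeasure η] {f : ℝ → ℝ} (hf : Measurable f) :
    Measurable (tailConv η f) := by
  have : Measurable fun p : ℝ × ℝ => f (p.1 - p.2) * η.real (Ioi p.2) :=
    (hf.comp (measurable_fst.sub measurable_snd)).mul
      ((antitone_tail η).measurable.comp measurable_snd)
  exact (this.stronglyMeasurable.integral_prod_right (ν := volume.restrict (Ioi 0))).measurable

theorem tailConv_of_neg {η : Measure ℝ} {f : ℝ → ℝ} (hf : ∀ x < 0, f x = 0) {u : ℝ} (hu : u < 0) :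
    tailConv η f u = 0 := by
  unfold tailConv
  rw [setIntegral_congr_fun (g := fun _ => 0) measurableSet_Ioi]
  · simp
  · intro y hy
    have : u - y < 0 := by have := mem_Ioi.1 hy; linarith
    simp [hf _ this]

theorem tailConv_nonneg {η : Measure ℝ} {f : ℝ → ℝ} (hf : ∀ x, 0 ≤ f x) (u : ℝ) :
    0 ≤ tailConv η f u :=
  integral_nonneg fun _ => mul_nonneg (hf _) measureReal_nonneg

theorem tailConv_le {η : Measure ℝ} [IsFiniteMeasure η]
    (hI : IntegrableOn (fun y => η.real (Ioi y)) (Ioi 0)) {f : ℝ → ℝ} (hf : Measurable f) {K : ℝ}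
    (hf0 : ∀ x, 0 ≤ f x) (hK : ∀ x, f x ≤ K) (u : ℝ) :
    tailConv η f u ≤ K * ∫ y in Ioi 0, η.real (Ioi y) := by
  rw [← integral_const_mul]
  exact integral_mono (integrable_mul_tail hI hf
    (fun x => by rw [abs_of_nonneg (hf0 x)]; exact hK x) u) (hI.const_mul K)
    fun y => mul_le_mul_of_nonneg_right (hK _) measureReal_nonneg

theorem tailConv_const_mul_add {η : Measure ℝ} [IsFiniteMeasure η]
    (hI : IntegrableOn (fun y => η.real (Ioi y)) (Ioi 0)) {f g : ℝ → ℝ} (hf : Measurable f)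
    (hg : Measurable g) {K K' : ℝ} (hK : ∀ x, |f x| ≤ K) (hK' : ∀ x, |g x| ≤ K') (a b u : ℝ) :
    tailConv η (fun x => a * f x + b * g x) u = a * tailConv η f u + b * tailConv η g u := by
  unfold tailConv
  rw [← integral_const_mul, ← integral_const_mul, ← integral_add
    ((integrable_mul_tail hI hf hK u).const_mul a) ((integrable_mul_tail hI hg hK' u).const_mul b)]
  congr 1
  funext y
  ring

/-- `n`-fold iterate of `tailConv`, applied to `1_{[0, ∞)}` -/
noncomputable def tailConvPow (η : Measure ℝ) : ℕ → ℝ → ℝ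
  | 0 => (Ici (0 : ℝ)).indicator 1
  | n + 1 => tailConv η (tailConvPow η n)

theorem measurable_tailConvPow (η : Measure ℝ) [IsFiniteMeasure η] (n : ℕ) :
    Measurable (tailConvPow η n) := by
  induction n with
  | zero => exact measurable_one.indicator measurableSet_Ici
  | succ n ih => exact measurable_tailConv ih

theorem tailConvPow_nonneg (η : Measure ℝ) (n : ℕ) (u : ℝ) : 0 ≤ tailConvPow η n u := by
  induction n generalizing u with
  | zero => exact indicator_nonneg (fun _ _ => zero_le_one) u
  | succ n ih => exact tailConv_nonneg ih u

theorem tailConvPow_of_neg (η : Measure ℝ) (n : ℕ) {u : ℝ} (hu : u < 0) :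
    tailConvPow η n u = 0 := by
  induction n generalizing u with
  | zero => exact indicator_of_notMem (by simpa using hu) _
  | succ n ih => exact tailConv_of_neg (fun x hx => ih hx) hu

theorem tailConvPow_le {η : Measure ℝ} [IsFiniteMeasure η]
    (hI : IntegrableOn (fun y => η.real (Ioi y)) (Ioi 0)) (n : ℕ) (u : ℝ) :
    tailConvPow η n u ≤ (∫ y in Ioi 0, η.real (Ioi y)) ^ n := by
  induction n generalizing u with
  | zero =>
    simp only [tailConvPow, pow_zero]
    exact indicator_le_self' (fun _ _ => zero_le_one) u
  | succ n ih =>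
    rw [pow_succ]
    exact tailConv_le hI (measurable_tailConvPow η n) (tailConvPow_nonneg η n) ih u

/-! ### The defective renewal equation -/

section Renewal

variable {η : Measure ℝ} [IsFiniteMeasure η] {c : ℝ} {φ : ℝ → ℝ}

/-- Dominated convergence with dominating function `η (y, ∞)`. The relation ties `φ 0` to the limit
at infinity. -/
theorem renewal_tendsto_eq (hI : IntegrableOn (fun y => η.real (Ioi y)) (Ioi 0))
    (hmono : Monotone φ) (h0 : ∀ x, 0 ≤ φ x) (h1 : ∀ x, φ x ≤ 1)
    (heq : ∀ u, 0 ≤ u → φ u = φ 0 + c⁻¹ * tailConv η φ u) {l : ℝ} (hl : Tendsto φ atTop (𝓝 l)) :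
    l = φ 0 + c⁻¹ * (l * ∫ y in Ioi 0, η.real (Ioi y)) := by
  have hT : Tendsto (tailConv η φ) atTop (𝓝 (∫ y in Ioi 0, l * η.real (Ioi y))) := by
    refine tendsto_integral_filter_of_dominated_convergence (fun y => 1 * η.real (Ioi y))
      (Eventually.of_forall fun u => ?_) (Eventually.of_forall fun u => ?_) (hI.const_mul 1)
      (Eventually.of_forall fun y => ?_)
    · exact (integrable_mul_tail hI hmono.measurable (K := 1)
        (fun x => by rw [abs_of_nonneg (h0 x)]; exact h1 x) u).aestronglyMeasurable
    · refine Eventually.of_forall fun y => ?_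
      rw [Real.norm_eq_abs, abs_of_nonneg (mul_nonneg (h0 _) measureReal_nonneg)]
      exact mul_le_mul_of_nonneg_right (h1 _) measureReal_nonneg
    · exact (hl.comp (tendsto_atTop_add_const_right _ (-y) tendsto_id)).mul_const _
  rw [integral_const_mul] at hT
  refine tendsto_nhds_unique hl (Tendsto.congr' ?_ ((hT.const_mul c⁻¹).const_add (φ 0)))
  filter_upwards [eventually_ge_atTop 0] with u hu
  exact (heq u hu).symm

/-- Where `φ` vanishes up to `a`, the integrand lives on `(0, u - a]` and is at most `φ u * η(ℝ)`
there. The length factor makes this a Gronwall-type bound. -/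
theorem tailConv_le_of_eq_zero (hmono : Monotone φ) (h0 : ∀ x, 0 ≤ φ x)
    {a u : ℝ} (ha : φ a = 0) (hau : a ≤ u) :
    tailConv η φ u ≤ η.real univ * ((u - a) * φ u) := by
  have e : ∀ y ∈ Ioi (0 : ℝ), φ (u - y) * η.real (Ioi y) =
      (Ioc 0 (u - a)).indicator (fun y => φ (u - y) * η.real (Ioi y)) y := by
    intro y hy
    by_cases hya : y ≤ u - a
    · rw [indicator_of_mem (show y ∈ Ioc 0 (u - a) from ⟨hy, hya⟩)]
    · rw [indicator_of_notMem (fun h => hya h.2)]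
      have : φ (u - y) = 0 := le_antisymm (ha ▸ hmono (by linarith)) (h0 _)
      rw [this, zero_mul]
  unfold tailConv
  rw [setIntegral_congr_fun measurableSet_Ioi e, setIntegral_indicator measurableSet_Ioc]
  have hsub : Ioi (0 : ℝ) ∩ Ioc 0 (u - a) = Ioc 0 (u - a) := by
    ext y; simp only [mem_inter_iff, mem_Ioi, mem_Ioc]; tauto
  rw [hsub]
  have hc : ∀ y ∈ Ioc 0 (u - a), ‖φ (u - y) * η.real (Ioi y)‖ ≤ φ u * η.real univ := by
    intro y hy
    rw [Real.norm_eq_abs, abs_of_nonneg (mul_nonneg (h0 _) measureReal_nonneg)]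
    exact mul_le_mul (hmono (by linarith [hy.1])) (measureReal_mono (subset_univ _))
      measureReal_nonneg (h0 _)
  have := norm_setIntegral_le_of_norm_le_const (μ := volume) (s := Ioc 0 (u - a))
    (by simp) hc
  rw [Real.volume_real_Ioc_of_le (by linarith), sub_zero] at this
  exact (le_abs_self _).trans (this.trans (le_of_eq (by ring)))

/-- When `m ≥ c`, the limit relation `l = φ 0 + l m / c` leaves no room for a positive `φ 0`. The
zero at `0` then propagates to the right in steps of fixed length. -/
theorem renewal_eq_zero (hI : IntegrableOn (fun y => η.real (Ioi y)) (Ioi 0)) (hc : 0 < c)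
    (hmono : Monotone φ) (h0 : ∀ x, 0 ≤ φ x) (h1 : ∀ x, φ x ≤ 1)
    (heq : ∀ u, 0 ≤ u → φ u = φ 0 + c⁻¹ * tailConv η φ u)
    (hm : c ≤ ∫ y in Ioi 0, η.real (Ioi y)) (u : ℝ) : φ u = 0 := by
  have hbdd : BddAbove (range φ) := ⟨1, by rintro _ ⟨x, rfl⟩; exact h1 x⟩
  have hl := tendsto_atTop_ciSup hmono hbdd
  have hl0 : 0 ≤ ⨆ x, φ x := (h0 0).trans (le_ciSup hbdd 0)
  have hz : φ 0 = 0 := by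
    refine le_antisymm ?_ (h0 0)
    have := renewal_tendsto_eq hI hmono h0 h1 heq hl
    set l := ⨆ x, φ x
    have h2 : l ≤ c⁻¹ * (l * ∫ y in Ioi 0, η.real (Ioi y)) := by
      calc l = c⁻¹ * (l * c) := by field_simp
        _ ≤ _ := by gcongr
    linarith
  -- The step length makes `c⁻¹ η(ℝ) δ ≤ 1 / 2`, so a zero at `n δ` yields `φ ≤ φ / 2` at `(n + 1)
  -- δ`; the `+ 1` keeps the denominator positive.
  set δ : ℝ := c / (2 * (η.real univ + 1)) with hδ
  have hη : 0 ≤ η.real univ := measureReal_nonneg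
  have hδ0 : 0 < δ := by positivity
  have step : ∀ n : ℕ, φ (n * δ) = 0 := by
    intro n
    induction n with
    | zero => simpa using hz
    | succ n ih =>
      have hle := tailConv_le_of_eq_zero (η := η) hmono h0 (a := n * δ) (u := (n + 1 : ℕ) * δ)
        ih (by push_cast; nlinarith)
      have e := heq ((n + 1 : ℕ) * δ) (by positivity)
      rw [hz, zero_add] at e
      set A := φ ((n + 1 : ℕ) * δ) with hA
      have hA0 : 0 ≤ A := h0 _
      have e2 : ((n + 1 : ℕ) : ℝ) * δ - n * δ = δ := by push_cast; ring
      rw [e2] at hle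
      have h3 : A ≤ c⁻¹ * (η.real univ * (δ * A)) := e.le.trans (by gcongr)
      have h4 : c⁻¹ * (η.real univ * (δ * A)) ≤ 1 / 2 * A := by
        have : c⁻¹ * (η.real univ * δ) ≤ 1 / 2 := by
          rw [hδ]
          field_simp
          linarith
        calc c⁻¹ * (η.real univ * (δ * A)) = (c⁻¹ * (η.real univ * δ)) * A := by ring
          _ ≤ _ := by gcongr
      linarith
  obtain ⟨n, hn⟩ := exists_nat_ge (u / δ)
  exact le_antisymm ((hmono ((div_le_iff₀ hδ0).1 hn)).trans (step n).le) (h0 u)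

/-- Substituting the equation into itself `n` times leaves a remainder of at most `(m / c) ^ n`,
because each tail convolution multiplies the supremum bound by at most `m`. -/
theorem renewal_hasSum (hI : IntegrableOn (fun y => η.real (Ioi y)) (Ioi 0)) (hc : 0 < c)
    (hneg : ∀ x < 0, φ x = 0) (hmono : Monotone φ) (h0 : ∀ x, 0 ≤ φ x) (h1 : ∀ x, φ x ≤ 1)
    (heq : ∀ u, 0 ≤ u → φ u = φ 0 + c⁻¹ * tailConv η φ u)
    (hm : ∫ y in Ioi 0, η.real (Ioi y) < c) (u : ℝ) :
    HasSum (fun n => φ 0 * (c⁻¹ ^ n * tailConvPow η n u)) (φ u) := by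
  set m := ∫ y in Ioi 0, η.real (Ioi y) with hmdef
  have hm0 : 0 ≤ m := integral_nonneg fun _ => measureReal_nonneg
  have heq' : ∀ u, φ u = φ 0 * tailConvPow η 0 u + c⁻¹ * tailConv η φ u := by
    intro u
    rcases lt_or_ge u 0 with hu | hu
    · rw [hneg u hu, tailConvPow_of_neg η 0 hu, tailConv_of_neg hneg hu]; simp
    · have : tailConvPow η 0 u = 1 := indicator_of_mem (show u ∈ Ici (0 : ℝ) from hu) _
      rw [this, mul_one]; exact heq u hu
  -- the remainder after `n` iterations
  have hit : ∀ n : ℕ, ∃ r : ℝ → ℝ, Measurable r ∧ (∀ x, 0 ≤ r x) ∧ (∀ x, r x ≤ m ^ n) ∧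
      ∀ u, φ u = ∑ k ∈ Finset.range n, φ 0 * (c⁻¹ ^ k * tailConvPow η k u) + c⁻¹ ^ n * r u ∧
        (∀ u, tailConv η φ u =
          ∑ k ∈ Finset.range n, φ 0 * (c⁻¹ ^ k * tailConvPow η (k + 1) u) +
            c⁻¹ ^ n * tailConv η r u) := by
    intro n
    induction n with
    | zero => exact ⟨φ, hmono.measurable, h0, by simpa using h1, fun u => by simp⟩
    | succ n ih =>
      obtain ⟨r, mr, r0, r1, hr⟩ := ih
      have mTr : Measurable (tailConv η r) := measurable_tailConv mr
      have Tr0 : ∀ x, 0 ≤ tailConv η r x := tailConv_nonneg r0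
      have Tr1 : ∀ x, tailConv η r x ≤ m ^ (n + 1) := fun x => by
        rw [pow_succ]; exact tailConv_le hI mr r0 r1 x
      have hT : ∀ u, tailConv η φ u = ∑ k ∈ Finset.range n,
          φ 0 * (c⁻¹ ^ k * tailConvPow η (k + 1) u) + c⁻¹ ^ n * tailConv η r u := (hr 0).2
      have hφ : ∀ u, φ u = ∑ k ∈ Finset.range (n + 1), φ 0 * (c⁻¹ ^ k * tailConvPow η k u) +
          c⁻¹ ^ (n + 1) * tailConv η r u := by
        intro u
        rw [heq' u, hT u, Finset.sum_range_succ', mul_add, Finset.mul_sum]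
        have : ∀ k, c⁻¹ * (φ 0 * (c⁻¹ ^ k * tailConvPow η (k + 1) u)) =
            φ 0 * (c⁻¹ ^ (k + 1) * tailConvPow η (k + 1) u) := fun k => by ring
        simp_rw [this]
        ring
      refine ⟨tailConv η r, mTr, Tr0, Tr1, fun u => ⟨hφ u, fun u => ?_⟩⟩
      have hr' : φ = fun x => ∑ k ∈ Finset.range n, φ 0 * (c⁻¹ ^ k * tailConvPow η k x) +
          c⁻¹ ^ n * r x := funext fun x => (hr x).1
      -- Comparing the expansions of orders `n` and `n + 1` splits the old remainder into the next
      -- term and the new remainder; convolving this identity advances the expansion of `tailConv η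
      -- φ`.
      have hrn : ∀ x, c⁻¹ ^ n * r x = φ 0 * c⁻¹ ^ n * tailConvPow η n x +
          c⁻¹ ^ (n + 1) * tailConv η r x := by
        intro x
        have h1 := (hr x).1
        have h2 := hφ x
        rw [Finset.sum_range_succ] at h2
        linarith
      -- The zero summand only produces the two-term shape of `tailConv_const_mul_add`.
      have hlin : tailConv η (fun x => c⁻¹ ^ n * r x + 0 * r x) u =
          tailConv η (fun x => φ 0 * c⁻¹ ^ n * tailConvPow η n x +
            c⁻¹ ^ (n + 1) * tailConv η r x) u := by
        simp_rw [zero_mul, add_zero]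
        rw [funext hrn]
      rw [tailConv_const_mul_add hI mr mr (K := m ^ n) (K' := m ^ n)
          (fun x => by rw [abs_of_nonneg (r0 x)]; exact r1 x)
          (fun x => by rw [abs_of_nonneg (r0 x)]; exact r1 x),
        tailConv_const_mul_add hI (measurable_tailConvPow η n) mTr (K := m ^ n) (K' := m ^ (n + 1))
          (fun x => by rw [abs_of_nonneg (tailConvPow_nonneg η n x)]; exact tailConvPow_le hI n x)
          (fun x => by rw [abs_of_nonneg (Tr0 x)]; exact Tr1 x)] at hlin
      rw [hT u, Finset.sum_range_succ]
      have e : tailConvPow η (n + 1) u = tailConv η (tailConvPow η n) u := rfl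
      rw [e]
      linarith
  have hq0 : 0 ≤ m / c := by positivity
  have hq1 : m / c < 1 := (div_lt_one hc).2 hm
  have hnn : ∀ n, 0 ≤ φ 0 * (c⁻¹ ^ n * tailConvPow η n u) := fun n =>
    mul_nonneg (h0 0) (mul_nonneg (by positivity) (tailConvPow_nonneg η n u))
  rw [hasSum_iff_tendsto_nat_of_nonneg hnn]
  have hrem : Tendsto (fun n => φ u - ∑ k ∈ Finset.range n, φ 0 * (c⁻¹ ^ k * tailConvPow η k u))
      atTop (𝓝 0) := by
    refine squeeze_zero (fun n => ?_) (fun n => ?_) (tendsto_pow_atTop_nhds_zero_of_lt_one hq0 hq1)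
    · obtain ⟨r, _, r0, _, hr⟩ := hit n
      rw [(hr u).1, add_sub_cancel_left]
      exact mul_nonneg (by positivity) (r0 u)
    · obtain ⟨r, _, _, r1, hr⟩ := hit n
      rw [(hr u).1, add_sub_cancel_left]
      calc c⁻¹ ^ n * r u ≤ c⁻¹ ^ n * m ^ n := by gcongr; exact r1 u
        _ = (m / c) ^ n := by rw [← mul_pow]; congr 1; ring
  have := hrem.const_sub (φ u)
  simpa using this

end Renewal

/-! ### From small-time expansions to the renewal equation -/

section SmallTime

variable {η : Measure ℝ} [IsFiniteMeasure η] {φ : ℝ → ℝ}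

theorem measurable_integral_shift (hφ : Measurable φ) :
    Measurable fun v => ∫ x, φ (v - x) ∂η := by
  have : Measurable (Function.uncurry fun v x : ℝ => φ (v - x)) :=
    hφ.comp (measurable_fst.sub measurable_snd)
  exact this.stronglyMeasurable.integral_prod_right.measurable

theorem abs_integral_shift_le (h0 : ∀ x, 0 ≤ φ x) (h1 : ∀ x, φ x ≤ 1) (v : ℝ) :
    |∫ x, φ (v - x) ∂η| ≤ η.real univ := by
  have := norm_integral_le_of_norm_le_const (μ := η) (f := fun x => φ (v - x)) (C := 1)
    (Eventually.of_forall fun x => by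
      rw [Real.norm_eq_abs, abs_of_nonneg (h0 _)]; exact h1 _)
  simpa using this

theorem intervalIntegrable_of_bounded {f : ℝ → ℝ} (hf : Measurable f) {K : ℝ} (hK : ∀ x, |f x| ≤ K)
    (a b : ℝ) : IntervalIntegrable f volume a b := by
  rw [intervalIntegrable_iff]
  exact Measure.integrableOn_of_bounded (M := K) (by simp) hf.aestronglyMeasurable
    (Eventually.of_forall hK)

/-- By Fubini the jump term becomes `∫₀ᵘ φ (u - y) η(-∞, y] dy`, and subtracting it from `η(ℝ) ∫₀ᵘ
φ` leaves the tail `η(y, ∞)`. That `φ` vanishes on the negatives and `η` lives on `[0, ∞)` puts all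
integrals on `(0, u]`. -/
theorem generator_integral_eq (hη : ∀ᵐ x ∂η, 0 ≤ x) (hneg : ∀ x < 0, φ x = 0)
    (hφ : Measurable φ) (h0 : ∀ x, 0 ≤ φ x) (h1 : ∀ x, φ x ≤ 1) {u : ℝ} (hu : 0 ≤ u) :
    ∫ v in (0 : ℝ)..u, (η.real univ * φ v - ∫ x, φ (v - x) ∂η) = tailConv η φ u := by
  have hb : ∀ x, |φ x| ≤ 1 := fun x => by rw [abs_of_nonneg (h0 x)]; exact h1 x
  have i1 : IntervalIntegrable (fun v => η.real univ * φ v) volume 0 u :=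
    (intervalIntegrable_of_bounded hφ hb 0 u).const_mul _
  have i2 : IntervalIntegrable (fun v => ∫ x, φ (v - x) ∂η) volume 0 u :=
    intervalIntegrable_of_bounded (measurable_integral_shift hφ) (abs_integral_shift_le h0 h1) 0 u
  rw [intervalIntegral.integral_sub i1 i2]
  have mcdf : Measurable fun y => η.real (Iic y) :=
    (show Monotone fun y => η.real (Iic y) from
      fun _ _ h => measureReal_mono (Iic_subset_Iic.2 h)).measurable
  have hshift : ∫ v in (0 : ℝ)..u, ∫ x, φ (v - x) ∂η =
      ∫ y in Ioc 0 u, φ (u - y) * η.real (Iic y) := by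
    rw [intervalIntegral.integral_of_le hu]
    have hint : Integrable (Function.uncurry fun v x => φ (v - x))
        ((volume.restrict (Ioc 0 u)).prod η) := by
      refine Integrable.of_bound (hφ.comp (measurable_fst.sub measurable_snd)).aestronglyMeasurable
        1 (Eventually.of_forall fun p => hb _)
    rw [integral_integral_swap hint]
    have hint' : Integrable (Function.uncurry fun x y => φ (u - y) * (Iic y).indicator 1 x)
        (η.prod (volume.restrict (Ioc 0 u))) := by
      refine Integrable.of_bound (Measurable.aestronglyMeasurable ?_) 1
        (Eventually.of_forall fun p => ?_)
      · refine (hφ.comp (measurable_const.sub measurable_snd)).mul ?_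
        exact measurable_one.indicator
          (measurableSet_le measurable_fst measurable_snd)
      · simp only [Function.uncurry]
        rw [norm_mul]
        refine mul_le_one₀ (hb _) (norm_nonneg _) ?_
        rw [indicator_apply]
        split_ifs <;> simp
    have hx : ∀ x, 0 ≤ x → ∫ v in Ioc 0 u, φ (v - x) =
        ∫ y in Ioc 0 u, φ (u - y) * (Iic y).indicator 1 x := by
      intro x hx0
      -- Substitution `y = u + x - v`; the part with `y > u` then contributes nothing because `φ`
      -- vanishes on the negatives.
      have e1 : ∫ v in Ioc 0 u, φ (v - x) = ∫ y in Ioc x (u + x), φ (u - y) := by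
        rw [← intervalIntegral.integral_of_le hu, ← intervalIntegral.integral_of_le (by linarith)]
        have := intervalIntegral.integral_comp_sub_left (a := x) (b := u + x)
          (fun v => φ (v - x)) (u + x)
        simp only [add_sub_cancel_right, sub_self] at this
        rw [← this]
        congr 1
        funext y
        congr 1
        ring
      rw [e1, ← integral_indicator measurableSet_Ioc, ← integral_indicator measurableSet_Ioc]
      refine integral_congr_ae ?_
      -- The interval is open at `x` while `Iic y` contains `x = y`; the discrepancy is a single
      -- point.
      have hne : ∀ᵐ y : ℝ, y ≠ x := by simp [ae_iff]
      filter_upwards [hne] with y hy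
      simp only [indicator_apply, mem_Ioc, mem_Iic, Pi.one_apply]
      by_cases h2 : x ≤ y
      · have h3 : x < y := lt_of_le_of_ne h2 (Ne.symm hy)
        by_cases h4 : y ≤ u
        · simp [h3, h4, h2, lt_of_le_of_lt hx0 h3, show y ≤ u + x by linarith]
        · have : φ (u - y) = 0 := hneg _ (by linarith)
          simp [this]
      · have h3 : ¬ x < y := fun h => h2 h.le
        simp [h2, h3]
    rw [integral_congr_ae (hη.mono hx), integral_integral_swap hint']
    refine integral_congr_ae (Eventually.of_forall fun y => ?_)
    simp only
    rw [integral_const_mul, integral_indicator_one measurableSet_Iic]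
  have hconst : ∫ v in (0 : ℝ)..u, η.real univ * φ v =
      ∫ y in Ioc 0 u, φ (u - y) * η.real univ := by
    rw [← intervalIntegral.integral_of_le hu]
    have := intervalIntegral.integral_comp_sub_left (a := 0) (b := u)
      (fun v => η.real univ * φ v) u
    simp only [sub_self, sub_zero] at this
    rw [← this]
    simp_rw [mul_comm]
  have htail : ∀ y, η.real (Ioi y) = η.real univ - η.real (Iic y) := by
    intro y
    rw [← compl_Iic, measureReal_compl measurableSet_Iic]
  have hJ : ∀ {k : ℝ → ℝ}, Measurable k → (∀ y, |k y| ≤ η.real univ) →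
      IntegrableOn (fun y => φ (u - y) * k y) (Ioc 0 u) := by
    intro k mk hk
    refine Measure.integrableOn_of_bounded (M := 1 * η.real univ) (by simp)
      ((hφ.comp (measurable_const_sub u)).mul mk).aestronglyMeasurable
      (Eventually.of_forall fun y => ?_)
    rw [norm_mul]
    exact mul_le_mul (hb _) (hk _) (norm_nonneg _) zero_le_one
  rw [hshift, hconst, ← integral_sub (hJ measurable_const fun y => by
      rw [abs_of_nonneg measureReal_nonneg]) (hJ mcdf fun y => by
      rw [abs_of_nonneg measureReal_nonneg]; exact measureReal_mono (subset_univ _))]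
  unfold tailConv
  rw [← integral_indicator measurableSet_Ioc, ← integral_indicator measurableSet_Ioi]
  congr 1
  funext y
  simp only [indicator_apply, mem_Ioc, mem_Ioi]
  by_cases h2 : 0 < y
  · by_cases h3 : y ≤ u
    · simp only [h2, h3, and_self, if_true, htail]; ring
    · have : φ (u - y) = 0 := hneg _ (by linarith)
      simp [this]
  · simp [h2]

/-- Integrated over `v ∈ [0, u]`, the difference of `ψ n (v + c h)` and `ψ n v` collapses to
integrals over the short intervals `[u, u + c h]` and `[0, c h]`. Divided by `h` these tend to `c φ
u` and `c φ 0`, while the error becomes `O(h)`. No derivative of `φ` is needed. -/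
theorem renewal_of_smallTime {c : ℝ} (hc : 0 < c) {ψ : ℕ → ℝ → ℝ} {h : ℕ → ℝ} {C : ℝ}
    (hh : ∀ n, 0 < h n) (hh0 : Tendsto h atTop (𝓝 0))
    (hψm : ∀ n, Monotone (ψ n)) (hψ0 : ∀ n x, 0 ≤ ψ n x) (hψ1 : ∀ n x, ψ n x ≤ 1)
    (hle : ∀ n x, φ x ≤ ψ n x) (hlim : ∀ x, Tendsto (fun n => ψ n (x + c * h n)) atTop (𝓝 (φ x)))
    (hexp : ∀ n v, 0 ≤ v → |ψ n v - ((1 - h n * η.real univ) * ψ n (v + c * h n) +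
      h n * ∫ x, ψ n (v + c * h n - x) ∂η)| ≤ C * h n ^ 2) {u : ℝ} (hu : 0 ≤ u) :
    c * (φ u - φ 0) = ∫ v in (0 : ℝ)..u, (η.real univ * φ v - ∫ x, φ (v - x) ∂η) := by
  set lam := η.real univ with hlam
  have hlam0 : 0 ≤ lam := measureReal_nonneg
  have mψ := fun n => (hψm n).measurable
  have bψ : ∀ n x, |ψ n x| ≤ 1 := fun n x => by rw [abs_of_nonneg (hψ0 n x)]; exact hψ1 n x
  have iψ : ∀ n a b, IntervalIntegrable (ψ n) volume a b := fun n a b =>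
    intervalIntegrable_of_bounded (mψ n) (bψ n) a b
  let G : ℕ → ℝ → ℝ := fun n v => lam * ψ n v - ∫ x, ψ n (v - x) ∂η
  have mG : ∀ n, Measurable (G n) := fun n =>
    ((mψ n).const_mul _).sub (measurable_integral_shift (mψ n))
  have bG : ∀ n v, |G n v| ≤ 2 * lam := fun n v => by
    refine (abs_sub _ _).trans ?_
    have h1 : |lam * ψ n v| ≤ lam := by
      rw [abs_mul, abs_of_nonneg hlam0]; exact mul_le_of_le_one_right hlam0 (bψ n v)
    have h2 := abs_integral_shift_le (η := η) (hψ0 n) (hψ1 n) v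
    linarith
  -- convergence of the generator term
  have hG : Tendsto (fun n => ∫ v in (0 : ℝ)..u, G n (v + c * h n)) atTop
      (𝓝 (∫ v in (0 : ℝ)..u, (lam * φ v - ∫ x, φ (v - x) ∂η))) := by
    refine intervalIntegral.tendsto_integral_filter_of_dominated_convergence (fun _ => 2 * lam)
      (Eventually.of_forall fun n =>
        ((mG n).comp (measurable_add_const _)).aestronglyMeasurable)
      (Eventually.of_forall fun n => Eventually.of_forall fun v _ => bG n _)
      (by simp) (Eventually.of_forall fun v _ => ?_)
    refine ((hlim v).const_mul lam).sub ?_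
    refine tendsto_integral_filter_of_dominated_convergence (fun _ => 1)
      (Eventually.of_forall fun n =>
        ((mψ n).comp (measurable_const_sub _)).aestronglyMeasurable)
      (Eventually.of_forall fun n => Eventually.of_forall fun x => bψ n _)
      (integrable_const _) (Eventually.of_forall fun x => ?_)
    have := hlim (v - x)
    refine this.congr fun n => ?_
    congr 1; ring
  -- local averages
  have havg : ∀ a, Tendsto (fun n => (h n)⁻¹ * ∫ v in a..(a + c * h n), ψ n v) atTop
      (𝓝 (c * φ a)) := by
    intro a
    have hab : ∀ n, a ≤ a + c * h n := fun n => by have := mul_pos hc (hh n); linarith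
    -- On the interval, `φ a ≤ ψ n a ≤ ψ n v ≤ ψ n (a + c h)`, and the last bound tends to `φ a`.
    refine tendsto_of_tendsto_of_tendsto_of_le_of_le (tendsto_const_nhds (x := c * φ a))
      ((hlim a).const_mul c) (fun n => ?_) (fun n => ?_)
    · have := intervalIntegral.integral_mono_on (hab n) (intervalIntegrable_const (c := φ a))
        (iψ n a _) (fun v hv => (hle n a).trans (hψm n hv.1))
      rw [intervalIntegral.integral_const, add_sub_cancel_left, smul_eq_mul] at this
      rw [le_inv_mul_iff₀ (hh n)]
      linarith
    · have := intervalIntegral.integral_mono_on (hab n) (iψ n a _)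
        (intervalIntegrable_const (c := ψ n (a + c * h n))) (fun v hv => hψm n hv.2)
      rw [intervalIntegral.integral_const, add_sub_cancel_left, smul_eq_mul] at this
      simp only
      rw [inv_mul_le_iff₀ (hh n)]
      linarith
  -- the integrated expansion
  have hid : ∀ n, |(h n)⁻¹ * (∫ v in u..(u + c * h n), ψ n v) -
      (h n)⁻¹ * (∫ v in (0 : ℝ)..(0 + c * h n), ψ n v) - ∫ v in (0 : ℝ)..u, G n (v + c * h n)| ≤
      C * u * h n := by
    intro n
    have e1 : ∫ v in (0 : ℝ)..u, ψ n (v + c * h n) = ∫ v in (c * h n)..(u + c * h n), ψ n v := by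
      rw [intervalIntegral.integral_comp_add_right (fun v => ψ n v), zero_add]
    have iψs : IntervalIntegrable (fun v => ψ n (v + c * h n)) volume 0 u :=
      intervalIntegrable_of_bounded ((mψ n).comp (measurable_add_const _)) (fun x => bψ n _) 0 u
    have iGs : IntervalIntegrable (fun v => G n (v + c * h n)) volume 0 u :=
      intervalIntegrable_of_bounded ((mG n).comp (measurable_add_const _)) (fun x => bG n _) 0 u
    have e2 : (∫ v in u..(u + c * h n), ψ n v) - (∫ v in (0 : ℝ)..(0 + c * h n), ψ n v) =
        (∫ v in (0 : ℝ)..u, ψ n (v + c * h n)) - ∫ v in (0 : ℝ)..u, ψ n v := by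
      rw [e1, zero_add]
      have a1 := intervalIntegral.integral_add_adjacent_intervals (iψ n 0 (c * h n))
        (iψ n (c * h n) (u + c * h n))
      have a2 := intervalIntegral.integral_add_adjacent_intervals (iψ n 0 u)
        (iψ n u (u + c * h n))
      linarith
    have e3 : ‖∫ v in (0 : ℝ)..u, (ψ n v - (ψ n (v + c * h n) - h n * G n (v + c * h n)))‖ ≤
        (C * h n ^ 2) * |u - 0| := by
      refine intervalIntegral.norm_integral_le_of_norm_le_const fun v hv => ?_
      rw [uIoc_of_le hu] at hv
      rw [Real.norm_eq_abs]
      refine le_trans (le_of_eq ?_) (hexp n v hv.1.le)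
      simp only [G]
      congr 1
      ring
    rw [intervalIntegral.integral_sub (iψ n 0 u) (iψs.sub (iGs.const_mul _)),
      intervalIntegral.integral_sub iψs (iGs.const_mul _), intervalIntegral.integral_const_mul,
      sub_zero, abs_of_nonneg hu, Real.norm_eq_abs] at e3
    have hn := hh n
    have e4 : (h n)⁻¹ * (∫ v in u..(u + c * h n), ψ n v) -
        (h n)⁻¹ * (∫ v in (0 : ℝ)..(0 + c * h n), ψ n v) - ∫ v in (0 : ℝ)..u, G n (v + c * h n) =
        -(h n)⁻¹ * ((∫ v in (0 : ℝ)..u, ψ n v) - ((∫ v in (0 : ℝ)..u, ψ n (v + c * h n)) -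
          h n * ∫ v in (0 : ℝ)..u, G n (v + c * h n))) := by
      rw [← mul_sub, e2]
      field_simp
      ring
    rw [e4, abs_mul, abs_neg, abs_of_pos (inv_pos.2 hn), inv_mul_le_iff₀ hn]
    exact e3.trans (le_of_eq (by ring))
  have hlimit := (((havg u).sub (havg 0)).sub hG)
  have hzero : Tendsto (fun n => C * u * h n) atTop (𝓝 0) := by
    simpa using hh0.const_mul (C * u)
  have := tendsto_nhds_unique hlimit (squeeze_zero_norm hid hzero)
  linarith

end SmallTime

/-! ### Tails of finite measures on the half-line, and convolution powers -/

theorem integrableOn_tail {η : Measure ℝ} [IsFiniteMeasure η] (hη : ∀ᵐ x ∂η, 0 ≤ x)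
    (hi : Integrable (fun x : ℝ => x) η) : IntegrableOn (fun y => η.real (Ioi y)) (Ioi 0) := by
  refine ⟨(antitone_tail η).measurable.aestronglyMeasurable, ?_⟩
  rw [hasFiniteIntegral_iff_enorm]
  have h := lintegral_eq_lintegral_meas_lt η hη hi.aemeasurable
  have e : ∀ y, ‖η.real (Ioi y)‖ₑ = η {a : ℝ | y < a} := by
    intro y
    rw [Real.enorm_eq_ofReal measureReal_nonneg, measureReal_def,
      ENNReal.ofReal_toReal (measure_ne_top _ _)]
    rfl
  simp_rw [e, ← h]
  exact hi.lintegral_lt_top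

theorem integral_tail {η : Measure ℝ} (hη : ∀ᵐ x ∂η, 0 ≤ x)
    (hi : Integrable (fun x : ℝ => x) η) : ∫ y in Ioi 0, η.real (Ioi y) = ∫ x, x ∂η :=
  (hi.integral_eq_integral_meas_lt hη).symm

/-- Both measures give the same mass to every half-open interval. This turns Stieltjes convolutions
into Lebesgue integrals. -/
theorem stieltjesMeasure_eq_withDensity {G : StieltjesFunction ℝ} {g : ℝ → ℝ}
    (hg0 : ∀ x, 0 ≤ g x) (hgi : IntegrableOn g (Ioi 0)) (hG : ∀ x, G x = ∫ y in Ioc 0 x, g y) :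
    G.measure = (volume.restrict (Ioi 0)).withDensity fun y => ENNReal.ofReal (g y) := by
  have hfin : ∫⁻ y in Ioi 0, ENNReal.ofReal (g y) ≠ ⊤ := hgi.lintegral_lt_top.ne
  have : IsFiniteMeasure ((volume.restrict (Ioi 0)).withDensity fun y => ENNReal.ofReal (g y)) :=
    isFiniteMeasure_withDensity hfin
  refine Measure.ext_of_Ioc _ _ fun a b hab => ?_
  have hs : ∀ a b : ℝ, IntegrableOn g (Ioc a b ∩ Ioi 0) := fun a b =>
    hgi.mono_set inter_subset_right
  have hG' : ∀ x, G x = ∫ y in Iic x ∩ Ioi 0, g y := fun x => by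
    rw [hG, inter_comm, Ioi_inter_Iic]
  rw [StieltjesFunction.measure_Ioc, withDensity_apply _ measurableSet_Ioc,
    Measure.restrict_restrict measurableSet_Ioc,
    ← ofReal_integral_eq_lintegral_ofReal (hs a b) (Eventually.of_forall hg0), hG', hG',
    ← Iic_union_Ioc_eq_Iic hab.le, union_inter_distrib_right,
    setIntegral_union _ (measurableSet_Ioc.inter measurableSet_Ioi)
      (hgi.mono_set inter_subset_right) (hs a b), add_sub_cancel_left]
  exact (Iic_disjoint_Ioc le_rfl).mono inter_subset_left inter_subset_left

/-- The measure `dG` has density `m⁻¹ η(y, ∞)` on `(0, ∞)`, and the cutoff at `t` is automatic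
because tail powers vanish on the negatives. The case `m = 0` is covered with `m⁻¹ = 0`. -/
theorem convPow_eq_tailConvPow {η : Measure ℝ} [IsFiniteMeasure η] {G : StieltjesFunction ℝ}
    {m : ℝ} (hm : 0 ≤ m)
    (hI : IntegrableOn (fun y => η.real (Ioi y)) (Ioi 0))
    (hG : ∀ x, G x = ∫ y in Ioc 0 x, m⁻¹ * η.real (Ioi y)) (n : ℕ) (t : ℝ) :
    convPow G n t = m⁻¹ ^ n * tailConvPow η n t := by
  have hG' := stieltjesMeasure_eq_withDensity (G := G)
    (g := fun y => m⁻¹ * η.real (Ioi y))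
    (fun y => mul_nonneg (inv_nonneg.2 hm) measureReal_nonneg) (hI.const_mul _) hG
  induction n generalizing t with
  | zero => simp [convPow, tailConvPow]
  | succ n ih =>
    have h1 : convPow G (n + 1) t = ∫ y in Icc 0 t, convPow G n (t - y) ∂G.measure := rfl
    have mdens : Measurable fun y => ENNReal.ofReal (m⁻¹ * η.real (Ioi y)) :=
      ((antitone_tail η).measurable.const_mul _).ennreal_ofReal
    rw [h1, hG', setIntegral_withDensity_eq_setIntegral_toReal_smul mdens
      (Eventually.of_forall fun _ => ENNReal.ofReal_lt_top) _ measurableSet_Icc,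
      Measure.restrict_restrict measurableSet_Icc]
    have h2 : tailConvPow η (n + 1) t =
        ∫ y in Ioi 0, tailConvPow η n (t - y) * η.real (Ioi y) := rfl
    rw [h2, ← integral_const_mul, ← integral_indicator (measurableSet_Icc.inter measurableSet_Ioi),
      ← integral_indicator measurableSet_Ioi]
    congr 1
    funext y
    simp only [indicator_apply, mem_inter_iff, mem_Icc, mem_Ioi]
    by_cases hy : 0 < y
    · have hnn : 0 ≤ m⁻¹ * η.real (Ioi y) := mul_nonneg (inv_nonneg.2 hm) measureReal_nonneg
      by_cases hyt : y ≤ t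
      · simp only [hy, hy.le, hyt, and_self, if_true, ih, ENNReal.toReal_ofReal hnn, smul_eq_mul]
        ring
      · have : tailConvPow η n (t - y) = 0 := tailConvPow_of_neg η n (by linarith)
        simp [hyt, this]
    · simp [hy]

/-! ### Random walks -/

section Walk

variable {Ω : Type*} [MeasurableSpace Ω] {P : Measure Ω}

theorem indepFun_head_tail {ξ : ℕ → Ω → ℝ} (hξ : iIndepFun ξ P) (mξ : ∀ k, Measurable (ξ k)) :
    IndepFun (ξ 0) (fun ω k => ξ (k + 1) ω) P := by
  have h := indep_iSup_of_disjoint (m := fun k => MeasurableSpace.comap (ξ k) inferInstance)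
    (fun k => (mξ k).comap_le) hξ.iIndep (S := {0}) (T := {0}ᶜ) disjoint_compl_right
  refine indep_of_indep_of_le_left (indep_of_indep_of_le_right h ?_) ?_
  · rw [MeasurableSpace.pi, MeasurableSpace.comap_iSup]
    refine iSup_le fun k => ?_
    rw [MeasurableSpace.comap_comp]
    exact le_iSup₂_of_le (f := fun k (_ : k ∈ ({0}ᶜ : Set ℕ)) =>
      MeasurableSpace.comap (ξ k) inferInstance) (k + 1) (by simp) le_rfl
  · exact le_iSup₂_of_le (f := fun k (_ : k ∈ ({0} : Set ℕ)) =>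
      MeasurableSpace.comap (ξ k) inferInstance) 0 rfl le_rfl

theorem measurableSet_walk_le (x : ℝ) : MeasurableSet {s : ℕ → ℝ | ∀ k, partialSum k s ≤ x} := by
  rw [ofPred_forall]
  exact MeasurableSet.iInter fun k => measurableSet_le (measurable_partialSum k) measurable_const

/-- First-step decomposition for the maximum of a random walk. -/
theorem walk_first_step [IsProbabilityMeasure P] {ξ : ℕ → Ω → ℝ} (hξ : iIndepFun ξ P) (mξ : ∀ k, Measurable (ξ k))
    {μ : Measure ℝ} (hμ : ∀ k, P.map (ξ k) = μ) {x : ℝ} (hx : 0 ≤ x) :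
    P.real {ω | ∀ k, partialSum k (fun i => ξ i ω) ≤ x} =
      ∫ y, P.real {ω | ∀ k, partialSum k (fun i => ξ i ω) ≤ x - y} ∂μ := by
  have hμp : IsProbabilityMeasure μ := hμ 0 ▸ Measure.isProbabilityMeasure_map (mξ 0).aemeasurable
  have mT : Measurable fun ω k => ξ (k + 1) ω := measurable_pi_lambda _ fun k => mξ _
  have mA : Measurable fun ω k => ξ k ω := measurable_pi_lambda _ mξ
  have hI : P.map (fun ω k => ξ k ω) = Measure.infinitePi fun _ : ℕ => μ := by
    rw [hξ.map_fun_eq_infinitePi_map mξ]; simp_rw [hμ]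
  have hI' : P.map (fun ω k => ξ (k + 1) ω) = Measure.infinitePi fun _ : ℕ => μ := by
    have h := iIndepFun.precomp (g := fun k : ℕ => k + 1) (fun a b h => Nat.succ_injective h) hξ
    rw [h.map_fun_eq_infinitePi_map fun k => mξ (k + 1)]
    simp_rw [hμ]
  have hprod := (indepFun_iff_map_prod_eq_prod_map_map (mξ 0).aemeasurable mT.aemeasurable).1
    (indepFun_head_tail hξ mξ)
  have hw : ∀ z, P.real {ω | ∀ k, partialSum k (fun i => ξ i ω) ≤ z} =
      (Measure.infinitePi fun _ : ℕ => μ).real {s | ∀ k, partialSum k s ≤ z} := by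
    intro z
    rw [← hI, map_measureReal_apply mA (measurableSet_walk_le z)]
    rfl
  simp_rw [hw]
  rw [← hw x]
  have hE : MeasurableSet {p : ℝ × (ℕ → ℝ) | ∀ k, p.1 + partialSum k p.2 ≤ x} := by
    rw [ofPred_forall]
    exact MeasurableSet.iInter fun k => measurableSet_le
      (measurable_fst.add ((measurable_partialSum k).comp measurable_snd)) measurable_const
  have hset : {ω | ∀ k, partialSum k (fun i => ξ i ω) ≤ x} =
      (fun ω => (ξ 0 ω, fun k => ξ (k + 1) ω)) ⁻¹'
        {p : ℝ × (ℕ → ℝ) | ∀ k, p.1 + partialSum k p.2 ≤ x} := by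
    ext ω
    simp only [mem_ofPred_eq, mem_preimage]
    have hs : ∀ k, partialSum (k + 1) (fun i => ξ i ω) =
        ξ 0 ω + partialSum k (fun i => ξ (i + 1) ω) := fun k => by
      simp only [partialSum, Finset.sum_range_succ']; ring
    constructor
    · intro h k
      rw [← hs k]; exact h (k + 1)
    · intro h k
      cases k with
      -- The empty sum is the only constraint not seen after the first step; it holds because `0 ≤
      -- x`.
      | zero => simpa [partialSum] using hx
      | succ k => rw [hs k]; exact h k
  rw [hset, ← map_measureReal_apply ((mξ 0).prodMk mT) hE, hprod, hμ 0, hI', measureReal_def,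
    Measure.prod_apply hE, ← integral_toReal (measurable_measure_prodMk_left hE).aemeasurable
      (Eventually.of_forall fun _ => measure_lt_top _ _)]
  refine integral_congr_ae (Eventually.of_forall fun y => ?_)
  simp only [measureReal_def]
  congr 2
  ext s
  simp only [mem_preimage, mem_ofPred_eq]
  exact forall_congr' fun k => by rw [le_sub_iff_add_le, add_comm]

end Walk

/-! ### Compound Poisson subordinators -/

/-- `J` is a nondecreasing process starting in `0`, whose increments over time grids are i.i.d.,
with jump measure `η`. -/
structure IsCompoundPoisson {Ω : Type*} [MeasurableSpace Ω] (J : ℝ≥0 → Ω → ℝ) (η : Measure ℝ)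
    (P : Measure Ω) : Prop where
  measurable : ∀ t, Measurable (J t)
  zero : ∀ᵐ ω ∂P, J 0 ω = 0
  monotone : ∀ᵐ ω ∂P, Monotone fun t => J t ω
  indep : ∀ h : ℝ≥0, iIndepFun (fun (k : ℕ) ω => J ((k + 1 : ℕ) * h) ω - J (k * h) ω) P
  law : ∀ (h : ℝ≥0) (k : ℕ), P.map (fun ω => J ((k + 1 : ℕ) * h) ω - J (k * h) ω) = P.map (J h)
  smallTime : HasSmallTimeExpansion (fun h => P.map (J h)) η
  integrable : Integrable (J 1) P
  mean : ∫ ω, J 1 ω ∂P = ∫ x, x ∂η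

/-- the dyadic time `k / 2 ^ m` -/
noncomputable def dyadicTime (m k : ℕ) : ℝ≥0 := k * (2 ^ m)⁻¹

theorem dyadicTime_refine {m n : ℕ} (h : m ≤ n) (k : ℕ) :
    dyadicTime m k = dyadicTime n (k * 2 ^ (n - m)) := by
  unfold dyadicTime
  obtain ⟨l, rfl⟩ := Nat.exists_eq_add_of_le h
  rw [Nat.add_sub_cancel_left, pow_add]
  push_cast
  have h1 : (2 : ℝ≥0) ^ m ≠ 0 := by positivity
  have h2 : (2 : ℝ≥0) ^ l ≠ 0 := by positivity
  field_simp

/-- the probability that `Y` stays below `x` at all dyadic times -/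
noncomputable def stayProb {Ω : Type*} [MeasurableSpace Ω] (P : Measure Ω) (Y : ℝ≥0 → Ω → ℝ)
    (x : ℝ) : ℝ :=
  P.real {ω | ∀ m k, Y (dyadicTime m k) ω ≤ x}

theorem measurableSet_stay {Ω : Type*} [MeasurableSpace Ω] {Y : ℝ≥0 → Ω → ℝ}
    (hY : ∀ t, Measurable (Y t)) (m : ℕ) (x : ℝ) :
    MeasurableSet {ω | ∀ k, Y (dyadicTime m k) ω ≤ x} := by
  rw [ofPred_forall]
  exact MeasurableSet.iInter fun k => measurableSet_le (hY _) measurable_const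

namespace IsCompoundPoisson

theorem grid_eq_partialSum {Ω : Type*} (J : ℝ≥0 → Ω → ℝ) (c : ℝ) (h : ℝ≥0) (ω : Ω) (k : ℕ) :
    partialSum k (fun i => J ((i + 1 : ℕ) * h) ω - J (i * h) ω - c * h) =
      J (k * h) ω - c * (k * h : ℝ≥0) - J 0 ω := by
  induction k with
  | zero => simp [partialSum]
  | succ k ih =>
    unfold partialSum at ih ⊢
    rw [Finset.sum_range_succ, ih]
    push_cast
    ring

variable {Ω : Type*} [MeasurableSpace Ω] {P : Measure Ω}
  {J : ℝ≥0 → Ω → ℝ} {η : Measure ℝ} {c : ℝ}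

theorem iIndepFun_step (hJ : IsCompoundPoisson J η P) (c : ℝ) (h : ℝ≥0) :
    iIndepFun (fun (k : ℕ) ω => J ((k + 1 : ℕ) * h) ω - J (k * h) ω - c * h) P :=
  (hJ.indep h).comp (fun _ x => x - c * h) fun _ => measurable_sub_const _

theorem map_step (hJ : IsCompoundPoisson J η P) (c : ℝ) (h : ℝ≥0) (k : ℕ) :
    P.map (fun ω => J ((k + 1 : ℕ) * h) ω - J (k * h) ω - c * h) =
      (P.map (J h)).map fun x => x - c * h := by
  rw [← hJ.law h k, Measure.map_map (measurable_sub_const _)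
    (show Measurable fun ω => J ((k + 1 : ℕ) * h) ω - J (k * h) ω from
      (hJ.measurable _).sub (hJ.measurable _))]
  rfl

/-- the probability of staying below `x` on the grid of mesh `2 ^ (-m)` -/
noncomputable def gridProb (P : Measure Ω) (J : ℝ≥0 → Ω → ℝ) (c : ℝ) (m : ℕ) (x : ℝ) : ℝ :=
  P.real {ω | ∀ k, J (dyadicTime m k) ω - c * dyadicTime m k ≤ x}

/-- At grid times the process is a random walk with steps distributed as `J h - c h`; after a first
jump part `y` the remaining allowance is `x + c h - y`. -/
theorem gridProb_first_step [IsProbabilityMeasure P] (hJ : IsCompoundPoisson J η P) (m : ℕ) {x : ℝ} (hx : 0 ≤ x) :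
    gridProb P J c m x =
      ∫ y, gridProb P J c m (x + c * (2 ^ m : ℝ≥0)⁻¹ - y) ∂(P.map (J (2 ^ m)⁻¹)) := by
  set h : ℝ≥0 := (2 ^ m)⁻¹ with hh
  set ξ : ℕ → Ω → ℝ := fun k ω => J ((k + 1 : ℕ) * h) ω - J (k * h) ω - c * h with hξ
  have mξ : ∀ k, Measurable (ξ k) := fun k =>
    ((hJ.measurable _).sub (hJ.measurable _)).sub_const _
  have hg : ∀ z, gridProb P J c m z = P.real {ω | ∀ k, partialSum k (fun i => ξ i ω) ≤ z} := by
    intro z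
    refine measureReal_congr ?_
    filter_upwards [hJ.zero] with ω hω
    refine propext (forall_congr' fun k => ?_)
    rw [hξ, grid_eq_partialSum, hω, sub_zero]
    rfl
  have key := walk_first_step (ξ := ξ) (hJ.iIndepFun_step c h) mξ (hJ.map_step c h) hx
  rw [hg, key]
  simp_rw [hg]
  have mG : Measurable fun y => P.real {ω | ∀ k, partialSum k (fun i => ξ i ω) ≤ x - y} := by
    have : Antitone fun y => P.real {ω | ∀ k, partialSum k (fun i => ξ i ω) ≤ x - y} :=
      fun a b hab => measureReal_mono fun ω hω k => (hω k).trans (by linarith)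
    exact this.measurable
  rw [integral_map (measurable_sub_const _).aemeasurable mG.aestronglyMeasurable]
  congr 1
  funext y
  congr 2
  ring_nf

theorem stayProb_mono [IsProbabilityMeasure P] (Y : ℝ≥0 → Ω → ℝ) : Monotone (stayProb P Y) := fun _ _ h =>
  measureReal_mono fun _ hω m k => (hω m k).trans h

theorem stayProb_of_neg [IsProbabilityMeasure P] (hJ : IsCompoundPoisson J η P) {x : ℝ} (hx : x < 0) :
    stayProb P (fun t ω => J t ω - c * t) x = 0 := by
  unfold stayProb
  rw [measureReal_eq_zero_iff, measure_eq_zero_iff_ae_notMem]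
  filter_upwards [hJ.zero] with ω hω hmem
  have := hmem 0 0
  simp [dyadicTime, hω] at this
  linarith

/-- Refining the grid adds constraints and the extra allowance `c 2^{-m}` decreases to `0`, so the
events decrease to the dyadic event and continuity from above applies. -/
theorem gridProb_tendsto [IsProbabilityMeasure P] (hJ : IsCompoundPoisson J η P) (hc : 0 ≤ c) (x : ℝ) :
    Tendsto (fun m => gridProb P J c m (x + c * (2 ^ m : ℝ≥0)⁻¹)) atTop
      (𝓝 (stayProb P (fun t ω => J t ω - c * t) x)) := by
  set E : ℕ → Set Ω := fun m =>
    {ω | ∀ k, J (dyadicTime m k) ω - c * dyadicTime m k ≤ x + c * (2 ^ m : ℝ≥0)⁻¹} with hE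
  have hanti : Antitone E := by
    refine antitone_nat_of_succ_le fun m ω hω k => ?_
    rw [dyadicTime_refine (Nat.le_succ m)]
    refine (hω _).trans ?_
    push_cast
    gcongr
    · norm_num
    · exact Nat.le_succ m
  have hinter : ⋂ m, E m = {ω | ∀ m k, J (dyadicTime m k) ω - c * dyadicTime m k ≤ x} := by
    ext ω
    simp only [mem_iInter, hE, mem_ofPred_eq]
    constructor
    · intro hω m k
      have ht : Tendsto (fun n : ℕ => x + c * ((2 ^ n : ℝ≥0)⁻¹ : ℝ≥0)) atTop (𝓝 (x + c * 0)) := by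
        refine tendsto_const_nhds.add (Tendsto.const_mul c ?_)
        have := tendsto_pow_atTop_nhds_zero_of_lt_one (r := (2⁻¹ : ℝ)) (by norm_num) (by norm_num)
        refine this.congr fun n => ?_
        push_cast
        rw [inv_pow]
      rw [mul_zero, add_zero] at ht
      refine ge_of_tendsto ht ?_
      filter_upwards [eventually_ge_atTop m] with n hn
      rw [dyadicTime_refine hn]
      exact_mod_cast hω n _
    · intro hω m k
      refine (hω m k).trans ?_
      have : 0 ≤ c * ((2 ^ m : ℝ≥0)⁻¹ : ℝ≥0) := mul_nonneg hc (NNReal.coe_nonneg _)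
      push_cast at this ⊢
      linarith
  have hmeas : ∀ m, MeasurableSet (E m) := fun m =>
    measurableSet_stay (Y := fun t ω => J t ω - c * t)
      (fun t => (hJ.measurable t).sub_const _) m _
  have := tendsto_measure_iInter_atTop (μ := P) (fun m => (hmeas m).nullMeasurableSet) hanti
    ⟨0, measure_ne_top _ _⟩
  rw [hinter] at this
  exact (ENNReal.tendsto_toReal (measure_ne_top _ _)).comp this

theorem generator_eq [IsProbabilityMeasure P] [IsFiniteMeasure η] (hJ : IsCompoundPoisson J η P) (hc : 0 < c) {u : ℝ} (hu : 0 ≤ u) :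
    c * (stayProb P (fun t ω => J t ω - c * t) u - stayProb P (fun t ω => J t ω - c * t) 0) =
      ∫ v in (0 : ℝ)..u, (η.real univ * stayProb P (fun t ω => J t ω - c * t) v -
        ∫ x, stayProb P (fun t ω => J t ω - c * t) (v - x) ∂η) := by
  obtain ⟨C, hC, hexp⟩ := hJ.smallTime
  have gmono : ∀ m, Monotone (gridProb P J c m) := fun m _ _ h =>
    measureReal_mono fun _ hω k => (hω k).trans h
  refine renewal_of_smallTime hc (ψ := gridProb P J c) (h := fun m => (2 ^ m : ℝ≥0)⁻¹) (C := C)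
    (fun m => by positivity) ?_ gmono (fun m x => measureReal_nonneg)
    (fun m x => measureReal_le_one)
    (fun m x => measureReal_mono (fun ω (hω : ∀ m k, _) => hω m)) (fun x => ?_) (fun m v hv => ?_) hu
  · have := tendsto_pow_atTop_nhds_zero_of_lt_one (r := (2⁻¹ : ℝ)) (by norm_num) (by norm_num)
    refine this.congr fun n => ?_
    push_cast
    rw [inv_pow]
  · exact_mod_cast hJ.gridProb_tendsto hc.le x
  · have h1 : ((2 ^ m : ℝ≥0)⁻¹ : ℝ≥0) ≤ 1 := inv_le_one_of_one_le₀ (one_le_pow₀ (by norm_num))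
    have := hexp _ h1 (fun y => gridProb P J c m (v + c * (2 ^ m : ℝ≥0)⁻¹ - y))
      ((gmono m).measurable.comp (measurable_const_sub _)) (fun y => by
        unfold gridProb
        rw [abs_of_nonneg measureReal_nonneg]; exact measureReal_le_one)
    rw [← hJ.gridProb_first_step m hv] at this
    simpa using this

theorem renewal_eq [IsProbabilityMeasure P] [IsFiniteMeasure η] (hJ : IsCompoundPoisson J η P) (hη : ∀ᵐ x ∂η, 0 ≤ x) (hc : 0 < c) {u : ℝ}
    (hu : 0 ≤ u) :
    stayProb P (fun t ω => J t ω - c * t) u = stayProb P (fun t ω => J t ω - c * t) 0 +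
      c⁻¹ * tailConv η (stayProb P fun t ω => J t ω - c * t) u := by
  have h := hJ.generator_eq hc hu
  rw [generator_integral_eq hη (fun x hx => hJ.stayProb_of_neg hx) (stayProb_mono _).measurable
    (fun _ => measureReal_nonneg) (fun _ => measureReal_le_one) hu] at h
  rw [← h]
  field_simp
  ring

/-- By `generator_eq`, `φ` agrees on `[0, ∞)` with a constant plus a multiple of a primitive, hence
with a continuous function. This later removes the difference between reaching and exceeding a
level. -/
theorem stayProb_tendsto_left [IsProbabilityMeasure P] [IsFiniteMeasure η] (hJ : IsCompoundPoisson J η P) (hc : 0 < c) {u : ℝ} (hu : 0 < u) :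
    Tendsto (fun n : ℕ => stayProb P (fun t ω => J t ω - c * t) (u - 1 / ((n : ℝ) + 1))) atTop
      (𝓝 (stayProb P (fun t ω => J t ω - c * t) u)) := by
  set φ := stayProb P (fun t ω => J t ω - c * t) with hφ
  have mφ : Measurable φ := (stayProb_mono _).measurable
  have h0 : ∀ x, 0 ≤ φ x := fun _ => measureReal_nonneg
  have h1 : ∀ x, φ x ≤ 1 := fun _ => measureReal_le_one
  have hint : ∀ a b, IntervalIntegrable
      (fun v => η.real univ * φ v - ∫ x, φ (v - x) ∂η) volume a b := fun a b =>
    ((intervalIntegrable_of_bounded mφ (K := 1)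
      (fun x => by rw [abs_of_nonneg (h0 x)]; exact h1 x) a b).const_mul _).sub
      (intervalIntegrable_of_bounded (measurable_integral_shift mφ) (abs_integral_shift_le h0 h1)
        a b)
  have hcont : Continuous fun u => φ 0 +
      c⁻¹ * ∫ v in (0 : ℝ)..u, (η.real univ * φ v - ∫ x, φ (v - x) ∂η) :=
    continuous_const.add (continuous_const.mul (intervalIntegral.continuous_primitive hint 0))
  have heq : ∀ u, 0 ≤ u → φ 0 +
      c⁻¹ * ∫ v in (0 : ℝ)..u, (η.real univ * φ v - ∫ x, φ (v - x) ∂η) = φ u := by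
    intro u hu
    rw [← hJ.generator_eq hc hu, ← hφ]
    field_simp
    ring
  have ht : Tendsto (fun n : ℕ => u - 1 / ((n : ℝ) + 1)) atTop (𝓝 u) := by
    simpa using tendsto_one_div_add_atTop_nhds_zero_nat.const_sub u
  have := (hcont.tendsto u).comp ht
  rw [heq u hu.le] at this
  refine this.congr' ?_
  filter_upwards [ht.eventually (lt_mem_nhds hu)] with n hn
  exact heq _ hn.le

/-- By the strong law, the walk at integer times has negative drift and is almost surely bounded
above; monotonicity of `J` controls the times in between. Continuity from below in the bound then
gives the limit. -/
theorem stayProb_tendsto_one [IsProbabilityMeasure P] (hJ : IsCompoundPoisson J η P) (hc : 0 ≤ c) (hm : ∫ x, x ∂η < c) :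
    Tendsto (stayProb P fun t ω => J t ω - c * t) atTop (𝓝 1) := by
  set ξ : ℕ → Ω → ℝ := fun k ω =>
    J ((k + 1 : ℕ) * 1) ω - J (k * 1) ω - c * (1 : ℝ≥0) with hξ
  have mξ : ∀ k, Measurable (ξ k) := fun k =>
    ((hJ.measurable _).sub (hJ.measurable _)).sub_const _
  have hlaw : ∀ k, P.map (ξ k) = (P.map (J 1)).map fun x => x - c * (1 : ℝ≥0) :=
    hJ.map_step c 1
  have hident : ∀ k, IdentDistrib (ξ k) (ξ 0) P P := fun k =>
    ⟨(mξ k).aemeasurable, (mξ 0).aemeasurable, by rw [hlaw, hlaw]⟩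
  have hid0 : IdentDistrib (ξ 0) (fun ω => J 1 ω - c) P P := by
    refine ⟨(mξ 0).aemeasurable, ((hJ.measurable 1).sub_const c).aemeasurable, ?_⟩
    rw [hlaw, Measure.map_map (measurable_sub_const _) (hJ.measurable 1)]
    congr 1
    funext ω
    simp
  have hi1 : Integrable (fun ω => J 1 ω - c) P := hJ.integrable.sub (integrable_const c)
  have hint : Integrable (ξ 0) P := hid0.integrable_iff.2 hi1
  have hmean : ∫ ω, ξ 0 ω ∂P < 0 := by
    rw [hid0.integral_eq, integral_sub hJ.integrable (integrable_const c), hJ.mean]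
    simpa using hm
  have hslln := strong_law_ae_real ξ hint
    (fun i j hij => (hJ.iIndepFun_step c 1).indepFun hij) hident
  have hbdd : ∀ᵐ ω ∂P, ∃ B : ℕ, ∀ m k, J (dyadicTime m k) ω - c * dyadicTime m k ≤ B := by
    filter_upwards [hslln, hJ.zero, hJ.monotone] with ω hω h0 hmono
    have hev := hω.eventually (gt_mem_nhds hmean)
    have hS : ∀ n : ℕ, ∑ i ∈ Finset.range n, ξ i ω = J n ω - c * n := by
      intro n
      have := grid_eq_partialSum J c 1 ω n
      rw [h0, sub_zero] at this
      simpa [partialSum, hξ] using this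
    obtain ⟨n0, hn0⟩ := eventually_atTop.1 hev
    have hb : BddAbove (range fun n : ℕ => J n ω - c * n) := by
      refine ⟨(∑ i ∈ Finset.range (n0 + 1), |J i ω - c * i|), ?_⟩
      rintro _ ⟨n, rfl⟩
      have hnn : 0 ≤ ∑ i ∈ Finset.range (n0 + 1), |J i ω - c * i| :=
        Finset.sum_nonneg fun _ _ => abs_nonneg _
      rcases le_or_gt n n0 with hn | hn
      · refine (le_abs_self _).trans ?_
        exact Finset.single_le_sum (f := fun i : ℕ => |J i ω - c * i|)
          (fun _ _ => abs_nonneg _) (Finset.mem_range.2 (Nat.lt_succ_of_le hn))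
      · have h2 := hn0 n hn.le
        rw [hS] at h2
        have h3 : (0 : ℝ) < n := by exact_mod_cast (Nat.zero_le _).trans_lt hn
        have := (div_lt_iff₀ h3).1 h2
        simp only
        linarith
    obtain ⟨B, hB⟩ := hb
    -- For `n ≤ t ≤ n + 1`, the value at `t` is at most `J (n + 1) - c n`, which exceeds the value
    -- at `n + 1` by `c`.
    obtain ⟨B', hB'⟩ := exists_nat_ge (B + c)
    refine ⟨B', fun m k => ?_⟩
    set t := dyadicTime m k
    obtain ⟨n, hn⟩ : ∃ n : ℕ, n = ⌊t⌋₊ := ⟨_, rfl⟩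
    have ht1 : t ≤ (n + 1 : ℕ) := by
      rw [hn]; push_cast; exact (Nat.lt_floor_add_one t).le
    have ht2 : (n : ℝ≥0) ≤ t := by rw [hn]; exact Nat.floor_le (zero_le)
    have ht2' : (n : ℝ) ≤ t := by exact_mod_cast ht2
    have h4 := hmono ht1
    have h5 := hB ⟨n + 1, rfl⟩
    simp only at h4 h5
    push_cast at h4 h5
    nlinarith
  have hmonoE : Monotone fun B : ℕ =>
      {ω | ∀ m k, J (dyadicTime m k) ω - c * dyadicTime m k ≤ B} := fun a b hab ω hω m k =>
    (hω m k).trans (by exact_mod_cast hab)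
  have hlim := tendsto_measure_iUnion_atTop (μ := P) hmonoE
  have hfull : P (⋃ B : ℕ, {ω | ∀ m k, J (dyadicTime m k) ω - c * dyadicTime m k ≤ B}) = 1 := by
    rw [← measure_univ (μ := P)]
    refine measure_congr (eventuallyEq_univ.2 ?_)
    filter_upwards [hbdd] with ω hω
    exact mem_iUnion.2 hω
  rw [hfull] at hlim
  have h1 : Tendsto (fun B : ℕ => stayProb P (fun t ω => J t ω - c * t) B) atTop (𝓝 1) := by
    exact (ENNReal.tendsto_toReal ENNReal.one_ne_top).comp hlim
  have hb : BddAbove (range (stayProb P fun t ω => J t ω - c * t)) :=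
    ⟨1, by rintro _ ⟨x, rfl⟩; exact measureReal_le_one⟩
  have h2 := tendsto_atTop_ciSup (stayProb_mono (P := P) fun t ω => J t ω - c * t) hb
  rwa [tendsto_nhds_unique h1 (h2.comp tendsto_natCast_atTop_atTop)]

end IsCompoundPoisson

/-! ### Jump processes, their multiples and their independent sums -/

section CompoundPoisson

variable {Ω : Type*} [MeasurableSpace Ω] {P : Measure Ω}

/-- the pure jump part `∑_{k < N(t)} X(k)` -/
noncomputable def jumpProcess {Ω : Type*} (N : ℝ≥0 → Ω → ℕ) (X : ℕ → Ω → ℝ) (t : ℝ≥0) (ω : Ω) : ℝ :=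
  partialSum (N t ω) fun k => X k ω

theorem measurable_jumpProcess {N : ℝ≥0 → Ω → ℕ} {X : ℕ → Ω → ℝ} (mN : ∀ t, Measurable (N t))
    (mX : ∀ k, Measurable (X k)) (t : ℝ≥0) : Measurable (jumpProcess N X t) := by
  have h : Measurable fun ω => (N t ω, fun k => X k ω) :=
    (mN t).prodMk (measurable_pi_lambda _ mX)
  exact measurable_partialSum_uncurry.comp h

theorem monotone_grid (h : ℝ≥0) : Monotone fun k : ℕ => (k : ℝ≥0) * h := fun a b hab => by
  have : (a : ℝ≥0) ≤ b := by exact_mod_cast hab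
  exact mul_le_mul_left this h

/-- Increments over a grid are sums of the `X k` over consecutive blocks whose lengths are the
i.i.d. Poisson increments of `N`, so the results on block sums give their laws and independence. -/
theorem isCompoundPoisson_jumpProcess [IsProbabilityMeasure P] {N : ℝ≥0 → Ω → ℕ} {X : ℕ → Ω → ℝ} {lam : ℝ≥0}
    {ν : Measure ℝ} [IsProbabilityMeasure ν] (hN : IsPoissonProcess N lam P)
    (mX : ∀ k, Measurable (X k)) (hX : iIndepFun X P) (hν : ∀ k, P.map (X k) = ν)
    (hpos : ∀ᵐ x ∂ν, 0 ≤ x) (hi : Integrable (fun x : ℝ => x) ν)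
    (hNX : IndepFun (fun ω t => N t ω) (fun ω k => X k ω) P) :
    IsCompoundPoisson (jumpProcess N X) (lam • ν) P := by
  have mJ := measurable_jumpProcess hN.measurable mX
  have hXpos : ∀ᵐ ω ∂P, ∀ k, 0 ≤ X k ω := by
    rw [ae_all_iff]
    intro k
    exact ae_of_ae_map (mX k).aemeasurable ((hν k).symm ▸ hpos)
  have hzero : ∀ᵐ ω ∂P, jumpProcess N X 0 ω = 0 := by
    filter_upwards [hN.zero] with ω hω
    simp [jumpProcess, partialSum, hω]
  have hmono : ∀ᵐ ω ∂P, Monotone fun t => jumpProcess N X t ω := by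
    filter_upwards [hN.monotone, hXpos] with ω hω hx s t hst
    exact Finset.sum_le_sum_of_subset_of_nonneg (Finset.range_subset_range.2 (hω hst))
      fun k _ _ => hx k
  -- the increments are block sums
  let D : ℝ≥0 → ℕ → Ω → ℕ := fun h k ω => N ((k + 1 : ℕ) * h) ω - N (k * h) ω
  have mD : ∀ h k, Measurable (D h k) := fun h k => (hN.measurable _).sub (hN.measurable _)
  have hD : ∀ h, iIndepFun (D h) P := fun h => hN.indepIncrements.nat (monotone_grid h)
  have lD : ∀ h k, P.map (D h k) = poissonMeasure (lam * h) := fun h k => by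
    have := (hN.law (k * h) ((k + 1 : ℕ) * h) (monotone_grid h (Nat.le_succ k))).map_eq
    have e : ((k + 1 : ℕ) : ℝ≥0) * h - k * h = h := by
      rw [← tsub_mul]; push_cast; rw [add_tsub_cancel_left, one_mul]
    rw [e] at this
    exact this
  have hDX : ∀ h, IndepFun (fun ω i => D h i ω) (fun ω k => X k ω) P := fun h => by
    have : Measurable fun (n : ℝ≥0 → ℕ) (i : ℕ) => n ((i + 1 : ℕ) * h) - n (i * h) :=
      measurable_pi_lambda _ fun i => (measurable_pi_apply _).sub (measurable_pi_apply _)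
    exact hNX.comp this measurable_id
  have hblock : ∀ h k, (fun ω => blockSum (fun l => D h l ω) k (fun i => X i ω)) =ᵐ[P]
      fun ω => jumpProcess N X ((k + 1 : ℕ) * h) ω - jumpProcess N X (k * h) ω := by
    intro h k
    filter_upwards [hN.zero, hN.monotone] with ω h0 hm
    have hsum : ∀ k : ℕ, ∑ l ∈ Finset.range k, D h l ω = N (k * h) ω := by
      intro k
      induction k with
      | zero => simp [h0]
      | succ k ih =>
        rw [Finset.sum_range_succ, ih]
        -- Monotonicity of the path makes the truncated subtraction exact, so the block lengths
        -- telescope.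
        exact Nat.add_sub_of_le (hm (monotone_grid h (Nat.le_succ k)))
    simp only [blockSum, hsum, jumpProcess]
  have hlaw : ∀ h k, P.map (fun ω => jumpProcess N X ((k + 1 : ℕ) * h) ω -
      jumpProcess N X (k * h) ω) = compoundLaw (poissonMeasure (lam * h)) ν := fun h k => by
    rw [← Measure.map_congr (hblock h k),
      map_blockSum_eq_compoundLaw (hD h) (mD h) (lD h) hX mX hν (hDX h) k]
  have hlaw0 : ∀ h, P.map (jumpProcess N X h) = compoundLaw (poissonMeasure (lam * h)) ν := by
    intro h
    rw [← hlaw h 0]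
    refine Measure.map_congr ?_
    filter_upwards [hzero] with ω hω
    simp [hω]
  refine ⟨mJ, hzero, hmono, fun h => ?_, fun h k => by rw [hlaw, hlaw0], ?_, ?_, ?_⟩
  · exact (iIndepFun_blockSum (hD h) (mD h) (lD h) hX mX hν (hDX h)).congr fun k => hblock h k
  · simp_rw [hlaw0]
    exact hasSmallTimeExpansion_compoundLaw lam ν
  · have := integrable_compoundLaw_poisson (lam * 1) hi
    rw [← hlaw0] at this
    exact this.comp_measurable (mJ 1)
  · have := integral_compoundLaw_poisson (lam * 1) hi
    rw [← hlaw0, integral_map (mJ 1).aemeasurable measurable_id'.aestronglyMeasurable] at this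
    rw [this, integral_smul_nnreal_measure, mul_one]
    rfl

theorem IsCompoundPoisson.const_mul {J : ℝ≥0 → Ω → ℝ} {η : Measure ℝ}
    (hJ : IsCompoundPoisson J η P) {s : ℝ} (hs : 0 ≤ s) :
    IsCompoundPoisson (fun t ω => s * J t ω) (η.map (s * ·)) P := by
  have ms : Measurable fun x : ℝ => s * x := measurable_const_mul s
  have hmap : ∀ t, P.map (fun ω => s * J t ω) = (P.map (J t)).map (s * ·) := fun t => by
    rw [Measure.map_map ms (hJ.measurable t)]; rfl
  refine ⟨fun t => (hJ.measurable t).const_mul s, ?_, ?_, fun h => ?_, fun h k => ?_, ?_,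
    hJ.integrable.const_mul s, ?_⟩
  · filter_upwards [hJ.zero] with ω hω
    rw [hω, mul_zero]
  · filter_upwards [hJ.monotone] with ω hω a b hab
    exact mul_le_mul_of_nonneg_left (hω hab) hs
  · have := (hJ.indep h).comp (fun _ x => s * x) fun _ => ms
    simpa only [Function.comp_def, mul_sub] using this
  · rw [hmap, ← hJ.law h k, Measure.map_map ms
      (show Measurable fun ω => J ((k + 1 : ℕ) * h) ω - J (k * h) ω from
        (hJ.measurable _).sub (hJ.measurable _))]
    simp only [Function.comp_def, mul_sub]
  · simp_rw [hmap]
    exact hJ.smallTime.map_mul s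
  · rw [integral_const_mul, hJ.mean, integral_map ms.aemeasurable
      measurable_id'.aestronglyMeasurable, integral_const_mul]

/-- Independence across components together with independence over steps within each makes the whole
array of increments independent; regrouping by steps gives independent increments of the sum. The
expansion follows by convolving one component at a time. -/
theorem IsCompoundPoisson.sum [IsProbabilityMeasure P] {ι : Type*} [Fintype ι] {J : ι → ℝ≥0 → Ω → ℝ} {η : ι → Measure ℝ}
    [∀ j, IsFiniteMeasure (η j)] (hJ : ∀ j, IsCompoundPoisson (J j) (η j) P)
    (hind : iIndepFun (fun j ω t => J j t ω) P) (hi : ∀ j, Integrable (fun x : ℝ => x) (η j)) :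
    IsCompoundPoisson (fun t ω => ∑ j, J j t ω) (∑ j, η j) P := by
  classical
  have mInc : ∀ h (k : ℕ) j, Measurable fun ω => J j ((k + 1 : ℕ) * h) ω - J j (k * h) ω :=
    fun h k j => ((hJ j).measurable _).sub ((hJ j).measurable _)
  -- the increments of all components are jointly independent
  have hcomp : ∀ h : ℝ≥0, iIndepFun (fun j ω (k : ℕ) =>
      J j ((k + 1 : ℕ) * h) ω - J j (k * h) ω) P := fun h =>
    hind.comp (fun _ (v : ℝ≥0 → ℝ) (k : ℕ) => v ((k + 1 : ℕ) * h) - v (k * h)) fun _ =>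
      measurable_pi_lambda _ fun k => (measurable_pi_apply _).sub (measurable_pi_apply _)
  have hjoint : ∀ h : ℝ≥0, iIndepFun (fun (k : ℕ) ω j =>
      J j ((k + 1 : ℕ) * h) ω - J j (k * h) ω) P := fun h => by
    refine iIndepFun_curry (X := fun (k : ℕ) j ω => J j ((k + 1 : ℕ) * h) ω - J j (k * h) ω)
      (mInc h) ?_
    have := iIndepFun_uncurry' (X := fun j (k : ℕ) ω => J j ((k + 1 : ℕ) * h) ω - J j (k * h) ω)
      (fun j k => mInc h k j) (hcomp h) (fun j => (hJ j).indep h)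
    exact iIndepFun.precomp (g := Prod.swap) Prod.swap_injective this
  have mS : Measurable fun v : ι → ℝ => ∑ j, v j :=
    Finset.measurable_sum _ fun j _ => measurable_pi_apply j
  refine ⟨fun t => Finset.measurable_sum _ fun j _ => (hJ j).measurable t, ?_, ?_, fun h => ?_,
    fun h k => ?_, ?_, integrable_finsetSum _ fun j _ => (hJ j).integrable, ?_⟩
  · filter_upwards [ae_all_iff.2 fun j => (hJ j).zero] with ω hω
    simp [hω]
  · filter_upwards [ae_all_iff.2 fun j => (hJ j).monotone] with ω hω a b hab
    exact Finset.sum_le_sum fun j _ => hω j hab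
  · have := (hjoint h).comp (fun _ v => ∑ j, v j) fun _ => mS
    simpa only [Function.comp_def, Finset.sum_sub_distrib] using this
  · have h1 : iIndepFun (fun j ω => J j ((k + 1 : ℕ) * h) ω - J j (k * h) ω) P :=
      hind.comp (fun _ (v : ℝ≥0 → ℝ) => v ((k + 1 : ℕ) * h) - v (k * h)) fun _ =>
        (measurable_pi_apply _).sub (measurable_pi_apply _)
    have h2 : iIndepFun (fun j ω => J j h ω) P :=
      hind.comp (fun _ (v : ℝ≥0 → ℝ) => v h) fun _ => measurable_pi_apply _
    have e1 : (fun ω => ∑ j, J j ((k + 1 : ℕ) * h) ω - ∑ j, J j (k * h) ω) =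
        (fun v : ι → ℝ => ∑ j, v j) ∘ fun ω j => J j ((k + 1 : ℕ) * h) ω - J j (k * h) ω := by
      funext ω
      simp only [Function.comp, Finset.sum_sub_distrib]
    have e2 : (fun ω => ∑ j, J j h ω) = (fun v : ι → ℝ => ∑ j, v j) ∘ fun ω j => J j h ω := rfl
    rw [e1, e2, ← Measure.map_map mS (measurable_pi_lambda _ (mInc h k)),
      ← Measure.map_map mS (measurable_pi_lambda _ fun j => (hJ j).measurable h),
      h1.map_fun_eq_pi_map fun j => (mInc h k j).aemeasurable,
      h2.map_fun_eq_pi_map fun j => ((hJ j).measurable h).aemeasurable]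
    simp_rw [fun j => (hJ j).law h k]
  · have key : ∀ S : Finset ι, HasSmallTimeExpansion
        (fun h => P.map fun ω => ∑ j ∈ S, J j h ω) (∑ j ∈ S, η j) := by
      intro S
      induction S using Finset.induction_on with
      | empty =>
        simpa using hasSmallTimeExpansion_dirac
      | insert a S ha ih =>
        have hconv : ∀ h, P.map (fun ω => ∑ j ∈ insert a S, J j h ω) =
            (P.map (J a h)).conv (P.map fun ω => ∑ j ∈ S, J j h ω) := by
          intro h
          have h2 : iIndepFun (fun j ω => J j h ω) P :=
            hind.comp (fun _ (v : ℝ≥0 → ℝ) => v h) fun _ => measurable_pi_apply _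
          have h3 := (h2.indepFun_finsetSum_of_notMem (fun j => (hJ j).measurable h) ha).symm
          have e : (∑ j ∈ S, fun ω => J j h ω) = fun ω => ∑ j ∈ S, J j h ω := by
            funext ω
            rw [Finset.sum_apply]
          rw [e] at h3
          rw [← h3.map_add_eq_map_conv_map ((hJ a).measurable h)
            (Finset.measurable_sum _ fun j _ => (hJ j).measurable h)]
          congr 1
          funext ω
          rw [Finset.sum_insert ha, Pi.add_apply]
        simp_rw [hconv]
        rw [Finset.sum_insert ha]
        have p1 : ∀ h, IsProbabilityMeasure (P.map (J a h)) := fun h =>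
          Measure.isProbabilityMeasure_map ((hJ a).measurable h).aemeasurable
        have p2 : ∀ h, IsProbabilityMeasure (P.map fun ω => ∑ j ∈ S, J j h ω) := fun h =>
          Measure.isProbabilityMeasure_map
            (Finset.measurable_sum _ fun j _ => (hJ j).measurable h).aemeasurable
        exact (hJ a).smallTime.conv ih
    exact key Finset.univ
  · rw [integral_finsetSum _ fun j _ => (hJ j).integrable,
      integral_finsetSum_measure fun j _ => hi j]
    exact Finset.sum_congr rfl fun j _ => (hJ j).mean

end CompoundPoisson

/-! ### Pollaczek-Khintchine series from the renewal equation -/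

/-- The limit `1` at infinity identifies `φ 0 = 1 - m / c`. Subtracting the renewal series from the
geometric one yields the complements `1 - G^{n*}`, and the term `n = 0` drops out because `u ≥ 0`.
-/
theorem renewal_pollaczekKhintchine {η : Measure ℝ} [IsFiniteMeasure η] {c : ℝ} {φ : ℝ → ℝ}
    {G : StieltjesFunction ℝ} {m : ℝ} (hI : IntegrableOn (fun y => η.real (Ioi y)) (Ioi 0))
    (hmη : ∫ y in Ioi 0, η.real (Ioi y) = m) (hc : 0 < c)
    (hneg : ∀ x < 0, φ x = 0) (hmono : Monotone φ) (h0 : ∀ x, 0 ≤ φ x) (h1 : ∀ x, φ x ≤ 1)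
    (heq : ∀ u, 0 ≤ u → φ u = φ 0 + c⁻¹ * tailConv η φ u) (hl : Tendsto φ atTop (𝓝 1))
    (hm : m < c) (hG : ∀ x, G x = ∫ y in Ioc 0 x, m⁻¹ * η.real (Ioi y)) {u : ℝ} (hu : 0 ≤ u) :
    HasSum (fun n => (m / c) ^ (n + 1) * (1 - convPow G (n + 1) u)) ((1 - φ u) / (1 - m / c)) := by
  have hm0 : 0 ≤ m := hmη ▸ integral_nonneg fun _ => measureReal_nonneg
  have hq0 : 0 ≤ m / c := by positivity
  have hq1 : m / c < 1 := (div_lt_one hc).2 hm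
  have hφ0 : φ 0 = 1 - m / c := by
    have := renewal_tendsto_eq hI hmono h0 h1 heq hl
    rw [hmη, one_mul] at this
    have e : c⁻¹ * m = m / c := by ring
    linarith
  have hpos : 0 < 1 - m / c := by linarith
  have hs := renewal_hasSum hI hc hneg hmono h0 h1 heq (hmη ▸ hm) u
  have hs' : HasSum (fun n => c⁻¹ ^ n * tailConvPow η n u) (φ u / (1 - m / c)) := by
    have := hs.mul_left (1 - m / c)⁻¹
    rw [hφ0] at this
    rw [div_eq_inv_mul]
    exact this.congr_fun fun n => by rw [inv_mul_cancel_left₀ hpos.ne']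
  have hterm : ∀ n, c⁻¹ ^ n * tailConvPow η n u = (m / c) ^ n * convPow G n u := by
    intro n
    rw [convPow_eq_tailConvPow hm0 hI hG]
    -- For `m = 0` the cancellation of `m` fails, but then all tail powers of positive order vanish.
    rcases hm0.eq_or_lt with hz | hmpos
    · cases n with
      | zero => simp
      | succ n =>
        have h2 := tailConvPow_le hI (n + 1) u
        rw [hmη, ← hz, zero_pow (Nat.succ_ne_zero n)] at h2
        have h3 : tailConvPow η (n + 1) u = 0 := le_antisymm h2 (tailConvPow_nonneg _ _ _)
        simp [h3]
    · rw [div_pow, inv_pow, inv_pow]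
      field_simp
  simp_rw [hterm] at hs'
  have hd := (hasSum_geometric_of_lt_one hq0 hq1).sub hs'
  rw [← hasSum_nat_add_iff' 1] at hd
  have h00 : convPow G 0 u = 1 := indicator_of_mem (show u ∈ Ici (0 : ℝ) from hu) _
  simp only [Finset.range_one, Finset.sum_singleton, pow_zero, one_mul, h00, sub_self,
    sub_zero] at hd
  rw [sub_div, one_div]
  exact hd.congr_fun fun n => by ring

/-! ### The weighted sum of objects for fixed shares -/

namespace NetworkModel

variable {Ω : Type*} [MeasurableSpace Ω] {P : Measure Ω} {q d : ℕ} (M : NetworkModel P q d)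

theorem isProbabilityMeasure_jump [IsProbabilityMeasure P] (j : Fin d) :
    IsProbabilityMeasure (M.ν j) :=
  (M.law_X j 0).map_eq ▸ Measure.isProbabilityMeasure_map (M.measurable_X j 0).aemeasurable

theorem jump_ae_nonneg [IsProbabilityMeasure P] (j : Fin d) : ∀ᵐ x ∂(M.ν j), 0 ≤ x := by
  have := M.isProbabilityMeasure_jump j
  have h := M.cdf_zero j
  rw [cdf_eq_real, measureReal_eq_zero_iff] at h
  filter_upwards [measure_eq_zero_iff_ae_notMem.1 h] with x hx
  exact (not_le.1 hx).le

/-- the jump measure of `∑ j, s j * V_j` -/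
noncomputable def jumpMeasure (s : Fin d → ℝ) : Measure ℝ :=
  ∑ j, (M.lam j • M.ν j).map (s j * ·)

/-- the drift of `∑ j, s j * V_j` -/
noncomputable def drift (s : Fin d → ℝ) : ℝ := ∑ j, s j * M.c j

instance isFiniteMeasure_jumpMeasure [IsProbabilityMeasure P] (s : Fin d → ℝ) :
    IsFiniteMeasure (M.jumpMeasure s) := by
  have := M.isProbabilityMeasure_jump
  unfold jumpMeasure
  infer_instance

theorem jumpMeasure_ae_nonneg [IsProbabilityMeasure P] {s : Fin d → ℝ} (hs : ∀ j, 0 ≤ s j) :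
    ∀ᵐ x ∂(M.jumpMeasure s), 0 ≤ x := by
  unfold jumpMeasure
  rw [ae_finsetSum_measure_iff]
  intro j _
  rw [ae_map_iff (measurable_const_mul (s j)).aemeasurable measurableSet_Ici]
  refine Measure.ae_smul_measure ?_ (M.lam j)
  filter_upwards [M.jump_ae_nonneg j] with x hx
  exact mul_nonneg (hs j) hx

theorem integrable_scaledJump (s : Fin d → ℝ) (j : Fin d) :
    Integrable (fun x : ℝ => x) ((M.lam j • M.ν j).map (s j * ·)) := by
  rw [integrable_map_measure measurable_id'.aestronglyMeasurable
    (measurable_const_mul (s j)).aemeasurable]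
  exact ((M.integrable_jump j).const_mul (s j)).smul_measure_nnreal

theorem integrable_jumpMeasure (s : Fin d → ℝ) :
    Integrable (fun x : ℝ => x) (M.jumpMeasure s) := by
  unfold jumpMeasure
  rw [integrable_finsetSum_measure]
  exact fun j _ => M.integrable_scaledJump s j

theorem integral_jumpMeasure (s : Fin d → ℝ) :
    ∫ x, x ∂(M.jumpMeasure s) = ∑ j, s j * M.lam j * M.mean j := by
  unfold jumpMeasure
  rw [integral_finsetSum_measure fun j _ => M.integrable_scaledJump s j]
  refine Finset.sum_congr rfl fun j _ => ?_
  rw [integral_map (measurable_const_mul (s j)).aemeasurable measurable_id'.aestronglyMeasurable,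
    integral_smul_nnreal_measure, integral_const_mul, NNReal.smul_def, smul_eq_mul, mean]
  ring

/-- A component with zero share has all its scaled jumps at `0`, hence no mass above `y ≥ 0`; this
matches the convention in `scaledTail`. -/
theorem jumpMeasure_tail [IsProbabilityMeasure P] {s : Fin d → ℝ} (hs : ∀ j, 0 ≤ s j) {y : ℝ}
    (hy : 0 ≤ y) :
    (M.jumpMeasure s).real (Ioi y) = ∑ j, M.lam j * scaledTail (M.ν j) (s j) y := by
  have := M.isProbabilityMeasure_jump
  unfold jumpMeasure
  rw [measureReal_def, Measure.finsetSum_apply, ENNReal.toReal_sum fun _ _ => measure_ne_top _ _]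
  refine Finset.sum_congr rfl fun j _ => ?_
  rw [← measureReal_def, map_measureReal_apply (measurable_const_mul (s j)) measurableSet_Ioi,
    measureReal_nnreal_smul_apply]
  congr 1
  unfold scaledTail
  split_ifs with h
  · have : (fun x => s j * x) ⁻¹' Ioi y = ∅ := by
      ext x; simp [h, hy]
    rw [this, measureReal_empty]
  · have hpos : 0 < s j := lt_of_le_of_ne (hs j) (Ne.symm h)
    have : (fun x => s j * x) ⁻¹' Ioi y = (Iic (y / s j))ᶜ := by
      ext x
      simp only [mem_preimage, mem_Ioi, mem_compl_iff, mem_Iic, not_le, div_lt_iff₀ hpos]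
      rw [mul_comm]
    rw [this, probReal_compl_eq_one_sub measurableSet_Iic, cdf_eq_real]

theorem measurable_V (j : Fin d) (t : ℝ≥0) : Measurable (M.V j t) :=
  (measurable_jumpProcess (M.poisson j).measurable (M.measurable_X j) t).sub_const _

theorem jumpProcess_eq (j : Fin d) (t : ℝ≥0) (ω : Ω) :
    jumpProcess (M.N j) (M.X j) t ω = M.V j t ω + M.c j * t := by
  simp [jumpProcess, V, compoundProcess, partialSum]

theorem isCompoundPoisson_weighted [IsProbabilityMeasure P] {s : Fin d → ℝ} (hs : ∀ j, 0 ≤ s j) :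
    IsCompoundPoisson (fun t ω => ∑ j, s j * jumpProcess (M.N j) (M.X j) t ω) (M.jumpMeasure s)
      P := by
  have := M.isProbabilityMeasure_jump
  refine IsCompoundPoisson.sum (fun j => (isCompoundPoisson_jumpProcess (M.poisson j)
    (M.measurable_X j) (M.indep_X j) (fun k => (M.law_X j k).map_eq) (M.jump_ae_nonneg j)
    (M.integrable_jump j) (M.indep_N_X j)).const_mul (hs j)) ?_
    (fun j => M.integrable_scaledJump s j)
  -- Independence is given for the paths of the `V_j`; adding back the drift recovers each jump
  -- process as a measurable function of its own path.
  have h := M.indep_V.comp (fun j (v : ℝ≥0 → ℝ) t => s j * (v t + M.c j * t)) fun j =>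
    measurable_pi_lambda _ fun t => ((measurable_pi_apply t).add_const _).const_mul _
  simp only [jumpProcess_eq]
  exact h

/-- the probability that `∑ j, s j * V_j` stays below `x` at all dyadic times -/
noncomputable def survival (s : Fin d → ℝ) (x : ℝ) : ℝ :=
  stayProb P (fun t ω => ∑ j, s j * M.V j t ω) x

theorem survival_eq (s : Fin d → ℝ) : M.survival s = stayProb P fun t ω =>
    ∑ j, s j * jumpProcess (M.N j) (M.X j) t ω - M.drift s * t := by
  funext x
  unfold survival
  congr 1
  funext t ω
  simp only [jumpProcess_eq, drift, Finset.sum_mul, ← Finset.sum_sub_distrib]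
  exact Finset.sum_congr rfl fun j _ => by ring

theorem drift_nonneg {s : Fin d → ℝ} (hs : ∀ j, 0 ≤ s j) : 0 ≤ M.drift s :=
  Finset.sum_nonneg fun j _ => mul_nonneg (hs j) (M.c_pos j).le

theorem eq_zero_of_drift_eq_zero {s : Fin d → ℝ} (hs : ∀ j, 0 ≤ s j) (h : M.drift s = 0)
    (j : Fin d) : s j = 0 := by
  have := (Finset.sum_eq_zero_iff_of_nonneg fun j _ =>
    mul_nonneg (hs j) (M.c_pos j).le).1 h j (Finset.mem_univ j)
  exact (mul_eq_zero.1 this).resolve_right (M.c_pos j).ne'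

theorem survival_of_drift_eq_zero [IsProbabilityMeasure P] {s : Fin d → ℝ} (hs : ∀ j, 0 ≤ s j)
    (h : M.drift s = 0) {x : ℝ} (hx : 0 ≤ x) : M.survival s x = 1 := by
  unfold survival stayProb
  simp [M.eq_zero_of_drift_eq_zero hs h, hx]

theorem survival_tendsto_left [IsProbabilityMeasure P] {s : Fin d → ℝ} (hs : ∀ j, 0 ≤ s j) {u : ℝ}
    (hu : 0 < u) :
    Tendsto (fun n : ℕ => M.survival s (u - 1 / ((n : ℝ) + 1))) atTop (𝓝 (M.survival s u)) := by
  rcases (M.drift_nonneg hs).eq_or_lt with h | h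
  · rw [M.survival_of_drift_eq_zero hs h.symm hu.le]
    have ht : Tendsto (fun n : ℕ => u - 1 / ((n : ℝ) + 1)) atTop (𝓝 u) := by
      simpa using tendsto_one_div_add_atTop_nhds_zero_nat.const_sub u
    refine tendsto_const_nhds.congr' ?_
    filter_upwards [ht.eventually (lt_mem_nhds hu)] with n hn
    exact (M.survival_of_drift_eq_zero hs h.symm hn.le).symm
  · rw [survival_eq]
    exact (M.isCompoundPoisson_weighted hs).stayProb_tendsto_left h hu

theorem share_eq_zero {Q : Finset (Fin q)} {j : Fin d} {ω : Ω} (h : ω ∉ M.edgeTo Q j) :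
    M.share Q j ω = 0 := by
  refine Finset.sum_eq_zero fun i hi => ?_
  refine indicator_of_notMem (fun hω => h ?_) _
  exact mem_iUnion₂.2 ⟨i, hi, hω⟩

/-- The indicator is redundant: without edges all shares vanish and the quotient is `0 / 0 = 0`. -/
theorem pkParam_eq (Q : Finset (Fin q)) (ω : Ω) :
    M.pkParam Q ω = (∑ j, M.share Q j ω * M.lam j * M.mean j) / M.drift fun j => M.share Q j ω := by
  unfold pkParam drift
  by_cases h : 0 < M.deg Q ω
  · rw [indicator_of_mem (show ω ∈ {ω | 0 < M.deg Q ω} from h), Pi.one_apply, mul_one]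
  · have hz : ∀ j, M.share Q j ω = 0 := by
      intro j
      refine Finset.sum_eq_zero fun i hi => ?_
      have h1 : M.deg Q ω = 0 := by omega
      have h2 := Finset.sum_eq_zero_iff.1 (Finset.sum_eq_zero_iff.1 h1 i hi) j (Finset.mem_univ j)
      refine indicator_of_notMem (fun hω => ?_) _
      rw [indicator_of_mem hω] at h2
      exact one_ne_zero h2
    simp [hz]

/-- The indicator of `Q ∼ j` is redundant as well, since an unconnected object has share `0` and
thus zero scaled tail. -/
theorem mixedTail_eq [IsProbabilityMeasure P] (Q : Finset (Fin q)) (ω : Ω) (x : ℝ) :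
    M.mixedTail Q ω x = ∫ y in Ioc 0 x, (∑ j, M.share Q j ω * M.lam j * M.mean j)⁻¹ *
      (M.jumpMeasure fun j => M.share Q j ω).real (Ioi y) := by
  have hs := fun j => M.share_nonneg Q j ω
  change M.mixedTailFun Q ω x = _
  unfold mixedTailFun
  rw [integral_const_mul, setIntegral_congr_fun measurableSet_Ioc
    (fun y hy => M.jumpMeasure_tail hs hy.1.le),
    integral_finsetSum _ fun j _ => (M.integrableOn_scaledTail Q j ω 0 x).const_mul _]
  congr 1
  refine Finset.sum_congr rfl fun j _ => ?_
  rw [integral_const_mul]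
  by_cases h : ω ∈ M.edgeTo Q j
  · rw [indicator_of_mem h, Pi.one_apply, mul_one]
  · rw [M.share_eq_zero h]
    simp [scaledTail]

/-- Pollaczek-Khintchine formula, given the adjacency matrix. -/
theorem hasSum_pkTerm [IsProbabilityMeasure P] (Q : Finset (Fin q)) {ω : Ω}
    (h : M.pkParam Q ω < 1) {x : ℝ} (hx : 0 ≤ x) :
    HasSum (fun n => M.pkTerm Q x ω (n + 1))
      ((1 - M.survival (fun j => M.share Q j ω) x) / (1 - M.pkParam Q ω)) := by
  set s := fun j => M.share Q j ω with hsdef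
  have hs : ∀ j, 0 ≤ s j := fun j => M.share_nonneg Q j ω
  have hp := M.pkParam_eq Q ω
  rcases (M.drift_nonneg hs).eq_or_lt with h0 | h0
  -- Drift `0` forces all shares to vanish: the process is identically `0`, survival is certain, and
  -- every term of positive order is `0`.
  · rw [← h0, div_zero] at hp
    rw [M.survival_of_drift_eq_zero hs h0.symm hx, sub_self, zero_div]
    simp only [pkTerm, hp, zero_pow (Nat.succ_ne_zero _), zero_mul]
    exact hasSum_zero
  · have hη := M.jumpMeasure_ae_nonneg hs
    have hJ := M.isCompoundPoisson_weighted hs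
    have hi := M.integrable_jumpMeasure s
    have hm : ∑ j, s j * M.lam j * M.mean j < M.drift s := by
      rw [hp, div_lt_one h0] at h; exact h
    have key := renewal_pollaczekKhintchine (φ := M.survival s) (G := M.mixedTail Q ω)
      (integrableOn_tail hη hi) ((integral_tail hη hi).trans (M.integral_jumpMeasure s)) h0
      (fun x hx => by rw [survival_eq]; exact hJ.stayProb_of_neg hx)
      (IsCompoundPoisson.stayProb_mono _) (fun _ => measureReal_nonneg)
      (fun _ => measureReal_le_one)
      (fun u hu => by rw [survival_eq]; exact hJ.renewal_eq hη h0 hu)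
      (by
        rw [survival_eq]
        exact hJ.stayProb_tendsto_one h0.le ((M.integral_jumpMeasure s).trans_lt hm))
      hm (M.mixedTail_eq Q ω) hx
    rw [hp]
    simpa only [pkTerm, hp] using key

theorem pkSeries_eq [IsProbabilityMeasure P] (Q : Finset (Fin q)) {ω : Ω}
    (h : M.pkParam Q ω < 1) {x : ℝ} (hx : 0 ≤ x) :
    M.pkSeries Q x ω = 1 - M.survival (fun j => M.share Q j ω) x := by
  have : 0 < 1 - M.pkParam Q ω := by linarith
  rw [pkSeries, (M.hasSum_pkTerm Q h hx).tsum_eq, mul_div_cancel₀ _ this.ne']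

/-- Zero drift would make the parameter `0`, so the drift is positive here and the mean jump rate is
at least the drift; this is the case of `renewal_eq_zero`. -/
theorem survival_eq_zero [IsProbabilityMeasure P] (Q : Finset (Fin q)) {ω : Ω}
    (h : 1 ≤ M.pkParam Q ω) (x : ℝ) : M.survival (fun j => M.share Q j ω) x = 0 := by
  set s := fun j => M.share Q j ω with hsdef
  have hs : ∀ j, 0 ≤ s j := fun j => M.share_nonneg Q j ω
  have hp := M.pkParam_eq Q ω
  rcases (M.drift_nonneg hs).eq_or_lt with h0 | h0
  · rw [← h0, div_zero] at hp
    linarith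
  · have hη := M.jumpMeasure_ae_nonneg hs
    have hi := M.integrable_jumpMeasure s
    refine renewal_eq_zero (η := M.jumpMeasure s) (integrableOn_tail hη hi) h0
      (IsCompoundPoisson.stayProb_mono _) (fun _ => measureReal_nonneg)
      (fun _ => measureReal_le_one)
      (fun u hu => by
        have := (M.isCompoundPoisson_weighted hs).renewal_eq hη h0 hu
        rwa [← survival_eq] at this) ?_ x
    rw [integral_tail hη hi, integral_jumpMeasure]
    rwa [hp, one_le_div h0] at h

end NetworkModel

/-! ### Averaging over the network, and the hitting event -/

namespace NetworkModel

variable {Ω : Type*} [MeasurableSpace Ω] {P : Measure Ω} {q d : ℕ} (M : NetworkModel P q d)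

theorem measurable_A (i : Fin q) (j : Fin d) : Measurable (M.A i j) :=
  (M.measurable_W i j).indicator (M.measurableSet_edge i j)

theorem measurable_share (Q : Finset (Fin q)) (j : Fin d) : Measurable (M.share Q j) :=
  Finset.measurable_sum _ fun i _ => M.measurable_A i j

theorem measurable_pkParam (Q : Finset (Fin q)) : Measurable (M.pkParam Q) := by
  rw [funext (M.pkParam_eq Q)]
  exact (Finset.measurable_sum _ fun j _ => ((M.measurable_share Q j).mul_const _).mul_const _).div
    (Finset.measurable_sum _ fun j _ => (M.measurable_share Q j).mul_const _)

theorem measurableSet_stay_prod (x : ℝ) :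
    MeasurableSet {p : (Fin d → ℝ) × (Fin d → ℝ≥0 → ℝ) |
      ∀ m k, ∑ j, p.1 j * p.2 j (dyadicTime m k) ≤ x} := by
  simp only [ofPred_forall]
  refine MeasurableSet.iInter fun m => MeasurableSet.iInter fun k => measurableSet_le
    (Finset.measurable_sum _ fun j _ => ?_) measurable_const
  exact ((measurable_pi_apply j).comp measurable_fst).mul
    ((measurable_pi_apply _).comp ((measurable_pi_apply j).comp measurable_snd))

theorem measurable_V_path : Measurable fun ω j t => M.V j t ω :=
  measurable_pi_lambda _ fun j => measurable_pi_lambda _ fun t => M.measurable_V j t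

theorem survival_eq_measure_prodMk (s : Fin d → ℝ) (x : ℝ) :
    M.survival s x = (P.map fun ω j t => M.V j t ω).real
      (Prod.mk s ⁻¹' {p : (Fin d → ℝ) × (Fin d → ℝ≥0 → ℝ) |
        ∀ m k, ∑ j, p.1 j * p.2 j (dyadicTime m k) ≤ x}) := by
  rw [map_measureReal_apply M.measurable_V_path
    (measurable_prodMk_left (measurableSet_stay_prod x))]
  rfl

theorem measurable_survival [IsProbabilityMeasure P] (x : ℝ) :
    Measurable fun s => M.survival s x := by
  have : IsProbabilityMeasure (P.map fun ω j t => M.V j t ω) :=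
    Measure.isProbabilityMeasure_map M.measurable_V_path.aemeasurable
  simp_rw [survival_eq_measure_prodMk, measureReal_def]
  exact (measurable_measure_prodMk_left (measurableSet_stay_prod x)).ennreal_toReal

theorem measurable_share_vec (Q : Finset (Fin q)) : Measurable fun ω j => M.share Q j ω :=
  measurable_pi_lambda _ (M.measurable_share Q)

/-- The shares are a measurable function of `A`, hence independent of the paths of `V`, and Fubini
integrates the survival probability over them. Restricting to countably many times makes the event
measurable in the product space. -/
theorem stayProb_eq_integral_survival [IsProbabilityMeasure P] (Q : Finset (Fin q)) (x : ℝ) :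
    stayProb P (fun t ω => ∑ j, M.share Q j ω * M.V j t ω) x =
      ∫ ω, M.survival (fun j => M.share Q j ω) x ∂P := by
  have : IsProbabilityMeasure (P.map fun ω j t => M.V j t ω) :=
    Measure.isProbabilityMeasure_map M.measurable_V_path.aemeasurable
  have hind : IndepFun (fun ω j => M.share Q j ω) (fun ω j t => M.V j t ω) P :=
    M.indep_A_V.comp (φ := fun (a : Fin q → Fin d → ℝ) j => ∑ i ∈ Q, a i j) (ψ := id)
      (measurable_pi_lambda _ fun j => Finset.measurable_sum _ fun i _ =>
        (measurable_pi_apply j).comp (measurable_pi_apply i)) measurable_id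
  have hprod := (indepFun_iff_map_prod_eq_prod_map_map (M.measurable_share_vec Q).aemeasurable
    M.measurable_V_path.aemeasurable).1 hind
  have hE := measurableSet_stay_prod (d := d) x
  have h1 : stayProb P (fun t ω => ∑ j, M.share Q j ω * M.V j t ω) x =
      (P.map fun ω => ((fun j => M.share Q j ω), fun j t => M.V j t ω)).real
        {p : (Fin d → ℝ) × (Fin d → ℝ≥0 → ℝ) | ∀ m k, ∑ j, p.1 j * p.2 j (dyadicTime m k) ≤ x} := by
    rw [map_measureReal_apply ((M.measurable_share_vec Q).prodMk M.measurable_V_path) hE]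
    rfl
  rw [h1, hprod, measureReal_def, Measure.prod_apply hE,
    ← integral_toReal (measurable_measure_prodMk_left hE).aemeasurable
      (Eventually.of_forall fun _ => measure_lt_top _ _)]
  simp_rw [← measureReal_def, ← survival_eq_measure_prodMk]
  rw [integral_map (M.measurable_share_vec Q).aemeasurable
    (M.measurable_survival x).aestronglyMeasurable]

theorem survival_nonneg (s : Fin d → ℝ) (x : ℝ) : 0 ≤ M.survival s x := measureReal_nonneg

theorem survival_le_one [IsProbabilityMeasure P] (s : Fin d → ℝ) (x : ℝ) : M.survival s x ≤ 1 :=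
  measureReal_le_one

theorem integrable_survival [IsProbabilityMeasure P] (Q : Finset (Fin q)) (x : ℝ)
    (μ : Measure Ω) [IsFiniteMeasure μ] :
    Integrable (fun ω => M.survival (fun j => M.share Q j ω) x) μ :=
  Integrable.of_bound
    ((M.measurable_survival x).comp (M.measurable_share_vec Q)).aestronglyMeasurable 1
    (Eventually.of_forall fun ω => by
      rw [Real.norm_eq_abs, abs_of_nonneg (M.survival_nonneg _ _)]; exact M.survival_le_one _ _)

theorem sum_R_sub (Q : Finset (Fin q)) (u : Fin q → ℝ) (t : ℝ≥0) (ω : Ω) :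
    ∑ i ∈ Q, (M.R i t ω - u i) = ∑ j, M.share Q j ω * M.V j t ω - ∑ i ∈ Q, u i := by
  rw [Finset.sum_sub_distrib]
  congr 1
  simp only [R, share, Finset.sum_mul]
  exact Finset.sum_comm

/-- Almost surely, the values of `∑ j, a j * V_j` are limits of values at dyadic times. -/
theorem ae_exists_dyadicTime_gt : ∀ᵐ ω ∂P, ∀ (a : Fin d → ℝ) (t : ℝ≥0) (x : ℝ),
    x < ∑ j, a j * M.V j t ω → ∃ m k, x < ∑ j, a j * M.V j (dyadicTime m k) ω := by
  filter_upwards [ae_all_iff.2 fun j => (M.poisson j).rightContinuous] with ω hω a t x hx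
  have hcont : ContinuousWithinAt (fun s => ∑ j, a j * M.V j s ω) (Ici t) t := by
    refine tendsto_finsetSum _ fun j _ => Tendsto.const_mul _ ?_
    have h1 : Tendsto (fun s => M.N j s ω) (𝓝[≥] t) (𝓝 (M.N j t ω)) := hω j t
    -- Being integer-valued, the counting path is constant just to the right of `t`, so there `V_j`
    -- is a constant minus the linear drift.
    rw [nhds_discrete, tendsto_pure] at h1
    have h2 : Tendsto (fun s : ℝ≥0 => ∑ k ∈ Finset.range (M.N j t ω), M.X j k ω - M.c j * s)
        (𝓝[≥] t) (𝓝 (M.V j t ω)) :=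
      Tendsto.mono_left (Continuous.tendsto (by fun_prop) t) nhdsWithin_le_nhds
    refine h2.congr' ?_
    filter_upwards [h1] with s hs
    simp [V, compoundProcess, hs]
  have hdy : Tendsto (fun m : ℕ => dyadicTime m ⌈t * 2 ^ m⌉₊) atTop (𝓝[≥] t) := by
    have hge : ∀ m : ℕ, t ≤ dyadicTime m ⌈t * 2 ^ m⌉₊ := fun m => by
      unfold dyadicTime
      rw [le_mul_inv_iff₀ (by positivity)]
      exact Nat.le_ceil _
    refine tendsto_nhdsWithin_iff.2 ⟨?_, Eventually.of_forall hge⟩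
    have hlim : Tendsto (fun m : ℕ => t + (2 ^ m : ℝ≥0)⁻¹) atTop (𝓝 t) := by
      have : Tendsto (fun m : ℕ => (2⁻¹ : ℝ≥0) ^ m) atTop (𝓝 0) :=
        NNReal.tendsto_pow_atTop_nhds_zero_of_lt_one (by
          rw [← NNReal.coe_lt_coe]; push_cast; norm_num)
      simpa [inv_pow] using this.const_add t
    refine tendsto_of_tendsto_of_tendsto_of_le_of_le tendsto_const_nhds hlim hge fun m => ?_
    unfold dyadicTime
    rw [mul_inv_le_iff₀ (by positivity), add_mul, inv_mul_cancel₀ (by positivity)]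
    exact (Nat.ceil_lt_add_one (zero_le)).le
  obtain ⟨m, hm⟩ := ((hcont.tendsto.comp hdy).eventually (lt_mem_nhds hx)).exists
  exact ⟨m, _, hm⟩

theorem measurableSet_stay_share (Q : Finset (Fin q)) (x : ℝ) :
    MeasurableSet {ω | ∀ m k, ∑ j, M.share Q j ω * M.V j (dyadicTime m k) ω ≤ x} := by
  rw [ofPred_forall]
  exact MeasurableSet.iInter fun m =>
    measurableSet_stay (Y := fun t ω => ∑ j, M.share Q j ω * M.V j t ω)
      (fun t => Finset.measurable_sum _ fun j _ =>
        (M.measurable_share Q j).mul (M.measurable_V j t)) m x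

/-- The hitting event agrees up to a null set with the event that the level is exceeded at a
dyadic time. -/
theorem hitting_ae_eq [IsProbabilityMeasure P] (Q : Finset (Fin q)) (u : Fin q → ℝ)
    (hsum : 0 < ∑ i ∈ Q, u i) :
    M.hitting Q u =ᵐ[P]
      {ω | ∀ m k, ∑ j, M.share Q j ω * M.V j (dyadicTime m k) ω ≤ ∑ i ∈ Q, u i}ᶜ := by
  set x := ∑ i ∈ Q, u i with hx
  set S : ℝ → Set Ω := fun z =>
    {ω | ∀ m k, ∑ j, M.share Q j ω * M.V j (dyadicTime m k) ω ≤ z} with hS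
  have mS : ∀ z, MeasurableSet (S z) := M.measurableSet_stay_share Q
  have hprob : ∀ z, P.real (S z)ᶜ = 1 - ∫ ω, M.survival (fun j => M.share Q j ω) z ∂P := fun z => by
    rw [probReal_compl_eq_one_sub (mS z), ← M.stayProb_eq_integral_survival Q z]
    rfl
  have hlow : (S x)ᶜ ⊆ M.hitting Q u := by
    intro ω hω
    simp only [hS, mem_compl_iff, mem_ofPred_eq, not_forall, not_le] at hω
    obtain ⟨m, k, h⟩ := hω
    refine ⟨dyadicTime m k, ?_⟩
    rw [sum_R_sub]
    linarith
  -- The hitting event is squeezed between exceeding `x` and exceeding every `x - 1 / (n + 1)` at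
  -- dyadic times. The outer bounds have equal probability by left continuity of the survival
  -- probability at `x > 0`.
  set B : Set Ω := ⋂ n : ℕ, (S (x - 1 / ((n : ℝ) + 1)))ᶜ with hB
  have hupp : M.hitting Q u ≤ᵐ[P] B := by
    filter_upwards [M.ae_exists_dyadicTime_gt] with ω hω
    rintro ⟨t, ht⟩
    rw [sum_R_sub] at ht
    refine mem_iInter.2 fun n => ?_
    have hn : 0 < 1 / ((n : ℝ) + 1) := by positivity
    obtain ⟨m, k, h⟩ := hω (fun j => M.share Q j ω) t (x - 1 / ((n : ℝ) + 1)) (by linarith)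
    simp only [hS, mem_compl_iff, mem_ofPred_eq, not_forall, not_le]
    exact ⟨m, k, h⟩
  have hsub : (S x)ᶜ ⊆ B := by
    refine subset_iInter fun n => compl_subset_compl.2 fun ω hω m k => (hω m k).trans ?_
    have hn : 0 < 1 / ((n : ℝ) + 1) := by positivity
    linarith
  have mB : MeasurableSet B := MeasurableSet.iInter fun n => (mS _).compl
  have hlim : Tendsto (fun n : ℕ => ∫ ω, M.survival (fun j => M.share Q j ω)
      (x - 1 / ((n : ℝ) + 1)) ∂P) atTop
      (𝓝 (∫ ω, M.survival (fun j => M.share Q j ω) x ∂P)) := by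
    refine tendsto_integral_of_dominated_convergence (fun _ => 1)
      (fun n => (M.integrable_survival Q _ P).aestronglyMeasurable) (integrable_const _)
      (fun n => Eventually.of_forall fun ω => ?_) (Eventually.of_forall fun ω =>
        M.survival_tendsto_left (fun j => M.share_nonneg Q j ω) hsum)
    rw [Real.norm_eq_abs, abs_of_nonneg (M.survival_nonneg _ _)]
    exact M.survival_le_one _ _
  have hle : P.real B ≤ P.real (S x)ᶜ := by
    rw [hprob]
    refine ge_of_tendsto' (hlim.const_sub 1) fun n => ?_
    rw [← hprob]
    exact measureReal_mono (iInter_subset _ n)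
  have hAB : (S x)ᶜ =ᵐ[P] B := by
    refine ae_eq_of_subset_of_measure_ge hsub ?_ (mS x).compl.nullMeasurableSet (measure_ne_top _ _)
    exact (ENNReal.toReal_le_toReal (measure_ne_top _ _) (measure_ne_top _ _)).1 hle
  exact (hupp.trans hAB.symm.le).antisymm hlow.eventuallyLE

end NetworkModel

end

theorem theorem3p1 {Ω : Type*} [MeasurableSpace Ω] (P : Measure Ω) [IsProbabilityMeasure P]
    {q d : ℕ} (M : NetworkModel P q d) (Q : Finset (Fin q)) (u : Fin q → ℝ)
    (hu : ∀ i, 0 ≤ u i) (hsum : 0 < ∑ i ∈ Q, u i) :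
    NullMeasurableSet (M.hitting Q u) P ∧
    (∀ ω, M.pkParam Q ω < 1 → Summable fun n : ℕ => M.pkTerm Q (∑ i ∈ Q, u i) ω (n + 1)) ∧
    Integrable (M.pkSeries Q (∑ i ∈ Q, u i)) (cond P {ω | M.pkParam Q ω < 1}) ∧
    P.real (M.hitting Q u) =
      P.real {ω | M.pkParam Q ω < 1} *
          ∫ ω, M.pkSeries Q (∑ i ∈ Q, u i) ω ∂(cond P {ω | M.pkParam Q ω < 1}) +
        P.real {ω | 1 ≤ M.pkParam Q ω} := by
  set x := ∑ i ∈ Q, u i with hx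
  have hae := M.hitting_ae_eq Q u hsum
  rw [← hx] at hae
  have mstay := M.measurableSet_stay_share Q x
  set E : Set Ω := {ω | M.pkParam Q ω < 1} with hE
  have mE : MeasurableSet E := measurableSet_lt (M.measurable_pkParam Q) measurable_const
  -- This is the ruin probability given the shares: it equals the series on `E` and `1` off `E`, so
  -- splitting its integral over `E` and `Eᶜ` gives the two summands.
  set f : Ω → ℝ := fun ω => 1 - M.survival (fun j => M.share Q j ω) x with hf
  have hfi : ∀ (μ : Measure Ω) [IsFiniteMeasure μ], Integrable f μ := fun μ _ =>
    (integrable_const 1).sub (M.integrable_survival Q x μ)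
  have hfeq : M.pkSeries Q x =ᵐ[cond P E] f := by
    filter_upwards [ae_cond_mem mE] with ω hω
    exact M.pkSeries_eq Q hω hsum.le
  refine ⟨mstay.compl.nullMeasurableSet.congr hae.symm,
    fun ω hω => (M.hasSum_pkTerm Q hω hsum.le).summable, (hfi _).congr hfeq.symm, ?_⟩
  have hcompl : {ω | 1 ≤ M.pkParam Q ω} = Eᶜ := by
    ext ω
    simp [hE]
  have h1 : P.real (M.hitting Q u) = ∫ ω, f ω ∂P := by
    have hcongr : P.real (M.hitting Q u) = P.real
        {ω | ∀ m k, ∑ j, M.share Q j ω * M.V j (dyadicTime m k) ω ≤ x}ᶜ := measureReal_congr hae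
    rw [hcongr, probReal_compl_eq_one_sub mstay, hf,
      integral_sub (integrable_const 1) (M.integrable_survival Q x P),
      ← M.stayProb_eq_integral_survival Q x]
    simp [stayProb]
  have h2 : P.real E * ∫ ω, f ω ∂(cond P E) = ∫ ω in E, f ω ∂P := by
    rw [ProbabilityTheory.cond, integral_smul_measure, smul_eq_mul, ENNReal.toReal_inv, ← measureReal_def]
    -- If `E` is null, both sides vanish, in accordance with the convention for the first summand.
    by_cases h0 : P.real E = 0
    · rw [h0, zero_mul, setIntegral_measure_zero _ ((measureReal_eq_zero_iff).1 h0)]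
    · rw [mul_inv_cancel_left₀ h0]
  have h3 : ∫ ω in Eᶜ, f ω ∂P = P.real Eᶜ := by
    rw [setIntegral_congr_fun (g := fun _ => (1 : ℝ)) mE.compl]
    · simp
    · intro ω hω
      have : 1 ≤ M.pkParam Q ω := not_lt.1 hω
      simp [hf, M.survival_eq_zero Q this x]
  rw [integral_congr_ae hfeq, h2, hcompl, ← h3, integral_add_compl mE (hfi P), h1]
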